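/- Let $\mathbf{k}$ be an algebraically closed field of characteristic zero, let $m_1,\dots,m_n$ be positive integers, and let $G=\mathbb{Z}_{m_1}\times\cdots\times\mathbb{Z}_{m_n}$, written multiplicatively, where $g_l$ is a fixed generator of the factor $\mathbb{Z}_{m_l}$. For every positive integer $m$ fix a primitive $m$-th root of unity $\zeta_m\in\mathbf{k}^*$. Write $(s_1,\dots,s_t)$ for the greatest common divisor and $[x]$ for the integer part of $x$. Let $A$ be the set of all families $\underline{\mathbf a}=(a_l,a_{st},a_{rst})$ of integers with $0\le a_l<m_l$ for $1\le l\le n$, $0\le a_{st}<(m_s,m_t)$ for $1\le s<t\le n$, and $0\le a_{rst}<(m_r,m_s,m_t)$ for $1\le r<s<t\le n$. For $\underline{\mathbf a}\in A$ define $\Phi_{\underline{\mathbf a}}:G\times G\times G\to\mathbf{k}^*$ by $$\Phi_{\underline{\mathbf a}}\big(g_1^{i_1}\cdots g_n^{i_n},\,g_1^{j_1}\cdots g_n^{j_n},\,g_1^{k_1}\cdots g_n^{k_n}\big)=\prod_{l=1}^{n}\zeta_{m_l}^{a_l i_l\left[\frac{j_l+k_l}{m_l}\right]}\prod_{1\le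 s<t\le n}\zeta_{m_t}^{a_{st}i_t\left[\frac{j_s+k_s}{m_s}\right]}\prod_{1\le r<s<t\le n}\zeta_{(m_r,m_s,m_t)}^{-a_{rst}k_r j_s i_t}$$ for $0\le i_l,j_l,k_l<m_l$. A cochain on $G$ is called normalized if it equals $1$ whenever one of its arguments is $1$; $G$ acts trivially on $\mathbf{k}^*$, and the coboundary of $J:G\times G\to\mathbf{k}^*$ is $(x,y,z)\mapsto J(y,z)J(xy,z)^{-1}J(x,yz)J(x,y)^{-1}$. Then $\{\Phi_{\underline{\mathbf a}}\mid\underline{\mathbf a}\in A\}$ is a complete set of representatives of the normalized $3$-cocycles on $G$ with values in $\mathbf{k}^*$ modulo coboundaries: every $\Phi_{\underline{\mathbf a}}$ is a normalized $3$-cocycle, and for every normalized $3$-cocycle $f$ there is exactly one $\underline{\mathbf a}\in A$ such that $f$ and $\Phi_{\underline{\mathbf a}}$ differ by a coboundary; for this $\underline{\mathbf a}$, they differ by the coboundary of a normalized $2$-cochain. Moreover $$H^3(G,\mathbf{k}^*)\cong\prod_{i=1}^{n}\mathbb{Z}_{m_i}\times\prod_{1\le i<j\le n}\mathbb{Z}_{(m_i,m_j)}\times\prod_{1\le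 i<j<k\le n}\mathbb{Z}_{(m_i,m_j,m_k)}.$$ -/

import Mathlib

namespace AbelianCocycles

section Bar

variable (G : Type*) [Group G] (M : Type*) [CommGroup M]

/-- The differential from 2-cochains to 3-cochains of the (inhomogeneous) bar complex of `G` with
coefficients in the trivial `G`-module `M`, written multiplicatively. -/
def d2 : (G → G → M) →* (G → G → G → M) where
  toFun J := fun x y z => J y z * (J (x * y) z)⁻¹ * J x (y * z) * (J x y)⁻¹
  map_one' := by
    funext x y z
    simp
  map_mul' J K := by
    funext x y z
    simp only [Pi.mul_apply, mul_inv]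
    ac_rfl

/-- The differential from 3-cochains to 4-cochains of the (inhomogeneous) bar complex of `G` with
coefficients in the trivial `G`-module `M`, written multiplicatively. -/
def d3 : (G → G → G → M) →* (G → G → G → G → M) where
  toFun f := fun x y z w =>
    f y z w * (f (x * y) z w)⁻¹ * f x (y * z) w * (f x y (z * w))⁻¹ * f x y z
  map_one' := by
    funext x y z w
    simp
  map_mul' f g := by
    funext x y z w
    simp only [Pi.mul_apply, mul_inv]
    ac_rfl

/-- The group of 3-cocycles of `G` with values in the trivial module `M`. -/
def Z3 : Subgroup (G → G → G → M) := (d3 G M).ker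

/-- The group of 3-coboundaries of `G` with values in the trivial module `M`. -/
def B3 : Subgroup (G → G → G → M) := (d2 G M).range

/-- The third cohomology group of `G` with coefficients in the trivial module `M`:
3-cocycles modulo 3-coboundaries. -/
abbrev H3 := Z3 G M ⧸ (B3 G M).subgroupOf (Z3 G M)

variable {G M}

/-- A 2-cochain is normalized if it takes the value `1` as soon as one argument is `1`. -/
def IsNormalized2 (J : G → G → M) : Prop :=
  ∀ x, J 1 x = 1 ∧ J x 1 = 1

/-- A 3-cochain is normalized if it takes the value `1` as soon as one argument is `1`. -/
def IsNormalized3 (f : G → G → G → M) : Prop :=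
  ∀ x y, f 1 x y = 1 ∧ f x 1 y = 1 ∧ f x y 1 = 1

end Bar

/-- Pairs of indices `s < t`. -/
abbrev Pairs (n : ℕ) := {p : Fin n × Fin n // p.1 < p.2}

/-- Triples of indices `r < s < t`. -/
abbrev Triples (n : ℕ) := {p : Fin n × Fin n × Fin n // p.1 < p.2.1 ∧ p.2.1 < p.2.2}

/-- The greatest common divisor `(m_s, m_t)`. -/
abbrev gcd2 {n : ℕ} (m : Fin n → ℕ) (p : Pairs n) : ℕ :=
  Nat.gcd (m p.1.1) (m p.1.2)

/-- The greatest common divisor `(m_r, m_s, m_t)`. -/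
abbrev gcd3 {n : ℕ} (m : Fin n → ℕ) (p : Triples n) : ℕ :=
  Nat.gcd (Nat.gcd (m p.1.1) (m p.1.2.1)) (m p.1.2.2)

/-- The set `A` of parameters `a = (a_l, a_st, a_rst)` with `0 ≤ a_l < m_l`,
`0 ≤ a_st < (m_s, m_t)` for `s < t`, and `0 ≤ a_rst < (m_r, m_s, m_t)` for `r < s < t`. -/
@[ext]
structure Param {n : ℕ} (m : Fin n → ℕ) where
  one : ∀ l : Fin n, Fin (m l)
  two : ∀ p : Pairs n, Fin (gcd2 m p)
  three : ∀ p : Triples n, Fin (gcd3 m p)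

section Phi

variable {k : Type*} [Field k] {n : ℕ} {m : Fin n → ℕ} {G : Type*} [CommGroup G]

/-- The isomorphism `e` amounts to the choice of generators `g_1, …, g_n` of the cyclic factors
(`g_l` is the element of `G` that `e` sends to the class of `1` in the `l`-th factor).
`expo e l x` is the exponent `i_l`, with `0 ≤ i_l < m_l` when `0 < m_l`, in the expression
`x = g_1 ^ i_1 ⋯ g_n ^ i_n`. -/
def expo (e : G ≃* ∀ l : Fin n, Multiplicative (ZMod (m l))) (l : Fin n) (x : G) : ℕ :=
  (Multiplicative.toAdd (e x l)).val

/-- The 3-cochain `Φ_a`: for `x`, `y`, `z` with exponents `i`, `j`, `k` respectively, its value is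
`∏_l ζ_{m_l} ^ (a_l i_l ⌊(j_l + k_l) / m_l⌋)`
`* ∏_{s<t} ζ_{m_t} ^ (a_st i_t ⌊(j_s + k_s) / m_s⌋)`
`* ∏_{r<s<t} ζ_{(m_r,m_s,m_t)} ^ (- a_rst k_r j_s i_t)`.
Here `/` is the integer part of the quotient of natural numbers. -/
def Phi (ζ : ℕ → kˣ) (e : G ≃* ∀ l : Fin n, Multiplicative (ZMod (m l))) (a : Param m) :
    G → G → G → kˣ := fun x y z =>
  (∏ l : Fin n,
      ζ (m l) ^ ((a.one l : ℕ) * expo e l x * ((expo e l y + expo e l z) / m l))) *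
  (∏ p : Pairs n,
      ζ (m p.1.2) ^ ((a.two p : ℕ) * expo e p.1.2 x *
        ((expo e p.1.1 y + expo e p.1.1 z) / m p.1.1))) *
  ∏ p : Triples n,
      (ζ (gcd3 m p) ^ ((a.three p : ℕ) * expo e p.1.1 z * expo e p.1.2.1 y *
        expo e p.1.2.2 x))⁻¹

end Phi

end AbelianCocycles

/-!
The proof compares a 3-cocycle `f` with the standard ones through numerical invariants, each a
homomorphism on 3-cochains that vanishes on coboundaries:

* `cyclicInv`, the value of `f` on the cycle `∑ [g|g^j|g]` of a cyclic factor;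
* `pairInv`, attached to two cyclic factors `⟨g⟩`, `⟨h⟩` of orders `p`, `q`: shuffling `[g]` into
  the cycle `∑ [h^j|h]` gives a quantity that a coboundary changes by `q` times an element, the
  symmetric construction changes by `-p` times the same element, and `pairInv` is the smallest
  combination in which the changes cancel;
* `altInv`, the antisymmetrization of `f`, which is trilinear on cocycles.

On a cocycle they are torsion elements, of orders dividing `m_l`, `(m_s, m_t)` and
`(m_r, m_s, m_t)` (`cyclicInv_nsmul`, `pairInv_nsmul`, `altInv_nsmul_gcd`), and on `Φ_a` they are
the powers, with exponents `a_l`, `a_st`, `a_rst`, of primitive roots of unity of exactly these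
orders (`invariants_Phi`). So distinct `Φ_a` are not cohomologous, and every possible system of
values is attained by some `Φ_a`.

It remains to see that a cocycle with trivial invariants is a coboundary (`exists_eq_delta2`). This
goes by induction on the number of cyclic factors, writing the group as `H × ⟨g⟩` where `f` may be
assumed to vanish on `H`. Explicit coboundaries make `f x y z` vanish for `z ∈ H`, then for
`x, y ∈ H`, then for `y ∈ H`. The only obstruction met on the way is the 2-cocycle
`(x, y) ↦ f x y g` on `H`; it is symmetric because `altInv` is trivial, hence it is a coboundary
because the coefficients are divisible (`exists_eq_of_symmetric`). What is left is the cup product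
of a homomorphism `φ` with the 2-cocycle of carries of `⟨g⟩` (`exists_eq_carry`). The triviality of
`cyclicInv` says that `φ g = 0`, and that of `pairInv` says that `φ` is, on `H`, divisible by the
order of `g` among homomorphisms, so that the cup product is a coboundary (`cupCarry_nsmul`).

All this takes place in a divisible coefficient group written additively, in which
`exists_nsmul_eq_zero_and_nsmul_eq` holds.
-/

set_option linter.unusedSectionVars false

namespace AbelianCocycles

/-! ### Cochains with additive coefficients -/

section Cochains

variable {G A : Type*} [CommGroup G] [AddCommGroup A]

/-- The differential `d2`, for a coefficient group written additively. -/
def delta2 : (G → G → A) →+ (G → G → G → A) where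
  toFun J x y z := J y z - J (x * y) z + J x (y * z) - J x y
  map_zero' := by funext x y z; simp
  map_add' J K := by funext x y z; simp only [Pi.add_apply]; abel

/-- The differential `d3`, for a coefficient group written additively. -/
def delta3 : (G → G → G → A) →+ (G → G → G → G → A) where
  toFun f x y z w := f y z w - f (x * y) z w + f x (y * z) w - f x y (z * w) + f x y z
  map_zero' := by funext x y z w; simp
  map_add' f g := by funext x y z w; simp only [Pi.add_apply]; abel

theorem delta2_apply (J : G → G → A) (x y z : G) :
    delta2 J x y z = J y z - J (x * y) z + J x (y * z) - J x y := rfl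

theorem cocycle_apply {f : G → G → G → A} (hf : delta3 f = 0) (x y z w : G) :
    f y z w - f (x * y) z w + f x (y * z) w - f x y (z * w) + f x y z = 0 :=
  congrFun (congrFun (congrFun (congrFun hf x) y) z) w

theorem delta3_delta2 (J : G → G → A) : delta3 (delta2 J) = 0 := by
  funext x y z w
  simp only [delta3, delta2, AddMonoidHom.coe_mk, ZeroHom.coe_mk, mul_assoc, Pi.zero_apply]
  abel

/-- The 3-cochain `f` vanishes as soon as one argument is `1`. -/
def Normalized (f : G → G → G → A) : Prop :=
  ∀ x y, f 1 x y = 0 ∧ f x 1 y = 0 ∧ f x y 1 = 0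

/-- Every 3-cocycle is cohomologous to a normalized one. -/
theorem exists_normalized {f : G → G → G → A} (hf : delta3 f = 0) :
    ∃ J, Normalized (f - delta2 J) := by
  refine ⟨fun x y => f 1 1 y - f x 1 1, ?_⟩
  have key : ∀ x z, f x 1 z = f 1 1 z + f x 1 1 := fun x z => by
    have := cocycle_apply hf x 1 1 z
    simp only [mul_one, one_mul] at this
    grind
  intro x y
  simp only [Pi.sub_apply, delta2_apply, mul_one, one_mul]
  have h1 := cocycle_apply hf 1 1 x y
  have h2 := cocycle_apply hf x y 1 1
  have h3 := key 1 1
  have h4 := key x y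
  simp only [mul_one, one_mul] at h1 h2 h3 h4
  refine ⟨?_, ?_, ?_⟩ <;> grind

theorem Normalized.add_delta2 {f : G → G → G → A} (hf : Normalized f) {J : G → G → A}
    (h1 : ∀ y, J 1 y = 0) (h2 : ∀ x, J x 1 = 0) : Normalized (f + delta2 J) := by
  intro x y
  simp [delta2_apply, h1, h2, (hf x y).1, (hf x y).2.1, (hf x y).2.2]

end Cochains

/-! ### Invariants of 3-cochains -/

section Invariants

variable {G A : Type*} [CommGroup G] [AddCommGroup A]

/-- The slant product of a 3-cochain with `g`: up to sign, the shuffle of `[g]` into `[x|y]`. -/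
def slant (g : G) : (G → G → G → A) →+ (G → G → A) where
  toFun f x y := f g x y - f x g y + f x y g
  map_zero' := by funext x y; simp
  map_add' f f' := by funext x y; simp only [Pi.add_apply]; abel

/-- For `g` of order dividing `m`, the value of a 3-cochain on the cycle `∑ [g|g^j|g]`
of the cyclic group generated by `g`. -/
def cyclicInv (g : G) (m : ℕ) : (G → G → G → A) →+ A where
  toFun f := ∑ j ∈ Finset.range m, f g (g ^ j) g
  map_zero' := by simp
  map_add' f f' := by simp [Finset.sum_add_distrib]

/-- For `h` of order dividing `m`, the value of a 3-cochain on the shuffle of `[g]` into the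
cycle `∑ [h^j|h]`. -/
def slantSum (g h : G) (m : ℕ) : (G → G → G → A) →+ A where
  toFun f := ∑ j ∈ Finset.range m, slant g f (h ^ j) h
  map_zero' := by simp
  map_add' f f' := by simp [Finset.sum_add_distrib]

/-- The combination of `slantSum g h` and `slantSum h g` that vanishes on coboundaries, for `g` of
order dividing `p` and `h` of order dividing `q`. -/
def pairInv (g h : G) (p q : ℕ) : (G → G → G → A) →+ A :=
  (p / p.gcd q) • slantSum g h q + (q / p.gcd q) • slantSum h g p

/-- The antisymmetrization of a 3-cochain. -/
def altInv (x y z : G) : (G → G → G → A) →+ A where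
  toFun f := slant z f x y - slant z f y x
  map_zero' := by simp
  map_add' f f' := by simp only [map_add, Pi.add_apply]; abel

theorem slant_apply (g : G) (f : G → G → G → A) (x y : G) :
    slant g f x y = f g x y - f x g y + f x y g := rfl

theorem cyclicInv_apply (g : G) (m : ℕ) (f : G → G → G → A) :
    cyclicInv g m f = ∑ j ∈ Finset.range m, f g (g ^ j) g := rfl

theorem slantSum_apply (g h : G) (m : ℕ) (f : G → G → G → A) :
    slantSum g h m f = ∑ j ∈ Finset.range m, slant g f (h ^ j) h := rfl

theorem pairInv_apply (g h : G) (p q : ℕ) (f : G → G → G → A) :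
    pairInv g h p q f = (p / p.gcd q) • slantSum g h q f + (q / p.gcd q) • slantSum h g p f := rfl

theorem altInv_apply (x y z : G) (f : G → G → G → A) :
    altInv x y z f = slant z f x y - slant z f y x := rfl

theorem sum_range_pow_sub_pow_succ (u : G → A) {g : G} {m : ℕ} (hg : g ^ m = 1) :
    ∑ j ∈ Finset.range m, (u (g ^ j) - u (g ^ (j + 1))) = 0 := by
  rw [Finset.sum_range_sub' (fun j => u (g ^ j)), hg, pow_zero, sub_self]

theorem cyclicInv_delta2 (J : G → G → A) {g : G} {m : ℕ} (hg : g ^ m = 1) :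
    cyclicInv g m (delta2 J) = 0 := by
  rw [cyclicInv_apply, ← neg_eq_zero, ← Finset.sum_neg_distrib,
    ← sum_range_pow_sub_pow_succ (fun x => J g x - J x g) hg]
  refine Finset.sum_congr rfl fun j _ => ?_
  simp only [delta2_apply, pow_succ, mul_comm g]
  abel

theorem slant_delta2 (J : G → G → A) (g x y : G) :
    slant g (delta2 J) x y =
      -((J g x - J x g) + (J g y - J y g) - (J g (x * y) - J (x * y) g)) := by
  simp only [slant_apply, delta2_apply, mul_comm _ g]
  abel

/-- A coboundary changes `slantSum g h m` by a multiple of `m`, and `slantSum h g` by the opposite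
element with another multiplicity; this is why only their combination `pairInv` is invariant. -/
theorem slantSum_delta2 (J : G → G → A) (g : G) {h : G} {m : ℕ} (hh : h ^ m = 1) :
    slantSum g h m (delta2 J) = -(m • (J g h - J h g)) := by
  rw [slantSum_apply, eq_comm, ← sub_eq_zero, ← neg_eq_zero,
    ← sum_range_pow_sub_pow_succ (fun x => - (J g x - J x g)) hh]
  simp only [slant_delta2, pow_succ, Finset.sum_sub_distrib, Finset.sum_add_distrib,
    Finset.sum_neg_distrib, Finset.sum_const, Finset.card_range, smul_sub]
  abel

theorem div_gcd_mul (p q : ℕ) : p / p.gcd q * q = q / p.gcd q * p := by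
  rw [Nat.div_mul_right_comm (Nat.gcd_dvd_left p q), Nat.div_mul_right_comm
    (Nat.gcd_dvd_right p q), mul_comm]

theorem pairInv_delta2 (J : G → G → A) {g h : G} {p q : ℕ} (hg : g ^ p = 1) (hh : h ^ q = 1) :
    pairInv g h p q (delta2 J) = 0 := by
  rw [pairInv_apply, slantSum_delta2 J g hh, slantSum_delta2 J h hg, smul_neg, smul_neg,
    smul_smul, smul_smul]
  rw [div_gcd_mul, ← neg_sub (J g h), smul_neg]
  abel

theorem altInv_delta2 (J : G → G → A) (x y z : G) : altInv x y z (delta2 J) = 0 := by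
  rw [altInv_apply, slant_delta2, slant_delta2, mul_comm y x]
  abel

/-- The sum of the cocycle conditions at `(g ^ i, g, g ^ j, g)` telescopes in `i` and in `j`. -/
theorem cyclicInv_nsmul {f : G → G → G → A} (hf : delta3 f = 0) {g : G} {m : ℕ}
    (hg : g ^ m = 1) : m • cyclicInv g m f = 0 := by
  have key : ∑ i ∈ Finset.range m, ∑ j ∈ Finset.range m,
      (f g (g ^ j) g - f (g ^ i * g) (g ^ j) g + f (g ^ i) (g * g ^ j) g
        - f (g ^ i) g (g ^ j * g) + f (g ^ i) g (g ^ j)) = 0 :=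
    Finset.sum_eq_zero fun i _ => Finset.sum_eq_zero fun j _ => cocycle_apply hf _ _ _ _
  have h1 : ∑ i ∈ Finset.range m, ∑ j ∈ Finset.range m,
      (f (g ^ i) (g ^ j) g - f (g ^ i * g) (g ^ j) g) = 0 := by
    rw [Finset.sum_comm]
    refine Finset.sum_eq_zero fun j _ => ?_
    simp only [← pow_succ]
    exact sum_range_pow_sub_pow_succ (fun x => f x (g ^ j) g) hg
  have h2 : ∑ i ∈ Finset.range m, ∑ j ∈ Finset.range m,
      (f (g ^ i) (g ^ j) g - f (g ^ i) (g * g ^ j) g) = 0 := by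
    refine Finset.sum_eq_zero fun i _ => ?_
    simp only [← pow_succ']
    exact sum_range_pow_sub_pow_succ (fun x => f (g ^ i) x g) hg
  have h3 : ∑ i ∈ Finset.range m, ∑ j ∈ Finset.range m,
      (f (g ^ i) g (g ^ j) - f (g ^ i) g (g ^ j * g)) = 0 := by
    refine Finset.sum_eq_zero fun i _ => ?_
    simp only [← pow_succ]
    exact sum_range_pow_sub_pow_succ (fun x => f (g ^ i) g x) hg
  simp only [Finset.sum_sub_distrib, Finset.sum_add_distrib, Finset.sum_const,
    Finset.card_range] at key h1 h2 h3
  rw [cyclicInv_apply]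
  linear_combination (norm := abel) key - h1 + h2 - h3

/-- The cocycle condition on the shuffles of `[x|y]` with `[a|b]`: the slant product
`slant x f (a, b)` fails to be additive in `x` by the failure of `slant a f (x, y)` to be additive
in `a`. -/
theorem slant_shuffle {f : G → G → G → A} (hf : delta3 f = 0) (x y a b : G) :
    (slant x f a b + slant y f a b - slant (x * y) f a b) +
      (slant a f x y + slant b f x y - slant (a * b) f x y) = 0 := by
  have h1 := cocycle_apply hf x y a b
  have h2 := cocycle_apply hf x a y b
  have h3 := cocycle_apply hf a x y b
  have h4 := cocycle_apply hf x a b y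
  have h5 := cocycle_apply hf a x b y
  have h6 := cocycle_apply hf a b x y
  simp only [slant_apply]
  simp only [mul_comm a x, mul_comm a y, mul_comm b x, mul_comm b y] at *
  linear_combination (norm := abel) h1 - h2 + h3 + h4 - h5 + h6

theorem slant_cocycle {f : G → G → G → A} (hf : delta3 f = 0) (g x y z : G) :
    slant g f y z - slant g f (x * y) z + slant g f x (y * z) - slant g f x y = 0 := by
  have h1 := cocycle_apply hf g x y z
  have h2 := cocycle_apply hf x g y z
  have h3 := cocycle_apply hf x y g z
  have h4 := cocycle_apply hf x y z g
  simp only [slant_apply]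
  simp only [mul_comm x g, mul_comm y g, mul_comm z g] at *
  linear_combination (norm := abel) -h1 + h2 - h3 + h4

theorem slantSum_mul {f : G → G → G → A} (hf : delta3 f = 0) (x y : G) {g : G} {m : ℕ}
    (hg : g ^ m = 1) :
    slantSum x g m f + slantSum y g m f - slantSum (x * y) g m f + m • slant g f x y = 0 := by
  have key : ∑ j ∈ Finset.range m, ((slant x f (g ^ j) g + slant y f (g ^ j) g
      - slant (x * y) f (g ^ j) g) +
      (slant (g ^ j) f x y + slant g f x y - slant (g ^ j * g) f x y)) = 0 :=
    Finset.sum_eq_zero fun j _ => slant_shuffle hf _ _ _ _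
  have h1 := sum_range_pow_sub_pow_succ (fun u => slant u f x y) hg
  simp only [← pow_succ, Finset.sum_sub_distrib, Finset.sum_add_distrib, Finset.sum_const,
    Finset.card_range] at key h1
  simp only [slantSum_apply]
  linear_combination (norm := abel) key - h1

/-- Summing `slantSum_mul` along the powers of `h`. -/
theorem slantSum_relation {f : G → G → G → A} (hf : delta3 f = 0) {g h : G} {p q : ℕ}
    (hg : g ^ p = 1) (hh : h ^ q = 1) :
    p • slantSum g h q f + q • slantSum h g p f = 0 := by
  have key : ∑ j ∈ Finset.range q, (slantSum (h ^ j) g p f + slantSum h g p f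
      - slantSum (h ^ j * h) g p f + p • slant g f (h ^ j) h) = 0 :=
    Finset.sum_eq_zero fun j _ => slantSum_mul hf _ _ hg
  have h1 := sum_range_pow_sub_pow_succ (fun u => slantSum u g p f) hh
  simp only [← pow_succ, Finset.sum_sub_distrib, Finset.sum_add_distrib, Finset.sum_const,
    Finset.card_range, ← Finset.smul_sum, ← slantSum_apply] at key h1
  linear_combination (norm := abel) key - h1

theorem pairInv_nsmul {f : G → G → G → A} (hf : delta3 f = 0) {g h : G} {p q : ℕ}
    (hg : g ^ p = 1) (hh : h ^ q = 1) : p.gcd q • pairInv g h p q f = 0 := by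
  rw [pairInv_apply, smul_add, smul_smul, smul_smul, Nat.mul_div_cancel' (Nat.gcd_dvd_left p q),
    Nat.mul_div_cancel' (Nat.gcd_dvd_right p q), slantSum_relation hf hg hh]

theorem altInv_rotate (x y z : G) (f : G → G → G → A) : altInv x y z f = altInv y z x f := by
  simp only [altInv_apply, slant_apply]; abel

theorem altInv_swap (x y z : G) (f : G → G → G → A) : altInv x y z f = -altInv y x z f := by
  simp only [altInv_apply]; abel

theorem altInv_self (x z : G) (f : G → G → G → A) : altInv x x z f = 0 := by
  simp only [altInv_apply]; abel

theorem altInv_mul {f : G → G → G → A} (hf : delta3 f = 0) (x x' y z : G) :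
    altInv (x * x') y z f = altInv x y z f + altInv x' y z f := by
  have h1 := slant_cocycle hf z x x' y
  have h2 := slant_cocycle hf z x y x'
  have h3 := slant_cocycle hf z y x x'
  simp only [altInv_apply]
  simp only [mul_comm y] at *
  linear_combination (norm := abel) -h1 + h2 - h3

theorem altInv_pow {f : G → G → G → A} (hf : delta3 f = 0) (x y z : G) (k : ℕ) :
    altInv (x ^ k) y z f = k • altInv x y z f := by
  induction k with
  | zero =>
    have := altInv_mul hf 1 1 y z
    rw [mul_one, left_eq_add] at this
    simpa using this
  | succ k ih => rw [pow_succ, altInv_mul hf, ih, succ_nsmul]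

theorem altInv_nsmul_gcd {f : G → G → G → A} (hf : delta3 f = 0) {x y z : G} {p q r : ℕ}
    (hx : x ^ p = 1) (hy : y ^ q = 1) (hz : z ^ r = 1) :
    ((p.gcd q).gcd r) • altInv x y z f = 0 := by
  have key : ∀ (u v w : G) (k : ℕ), u ^ k = 1 → k • altInv u v w f = 0 := fun u v w k hu => by
    rw [← altInv_pow hf, hu, ← pow_zero u, altInv_pow hf, zero_smul]
  have h1 := key x y z p hx
  have h2 := key y z x q hy
  have h3 := key z x y r hz
  rw [← altInv_rotate] at h2
  rw [altInv_rotate] at h3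
  rw [← addOrderOf_dvd_iff_nsmul_eq_zero] at *
  exact Nat.dvd_gcd (Nat.dvd_gcd h1 h2) h3

end Invariants

/-! ### Symmetric 2-cocycles with divisible coefficients -/

section Symmetric

variable {G A : Type*} [CommGroup G] [AddCommGroup A]

/-- The underlying set of the extension of `G` by `A` defined by the 2-cocycle `c`. -/
structure TwistedProduct (c : G → G → A) where
  base : G
  fiber : A

instance (c : G → G → A) : Add (TwistedProduct c) :=
  ⟨fun u v => ⟨u.base * v.base, u.fiber + v.fiber + c u.base v.base⟩⟩

instance (c : G → G → A) : Zero (TwistedProduct c) := ⟨⟨1, 0⟩⟩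

instance (c : G → G → A) : Neg (TwistedProduct c) :=
  ⟨fun u => ⟨u.base⁻¹, -u.fiber - c u.base⁻¹ u.base⟩⟩

/-- The extension of `G` by `A` defined by a symmetric normalized 2-cocycle, which is commutative.
It is written additively, so as to be a `ℤ`-module. -/
abbrev TwistedProduct.addCommGroup {c : G → G → A}
    (hc : ∀ x y z, c y z - c (x * y) z + c x (y * z) - c x y = 0)
    (hs : ∀ x y, c x y = c y x) (h1 : ∀ x, c 1 x = 0) : AddCommGroup (TwistedProduct c) where
  add_assoc u v w := by
    change TwistedProduct.mk _ _ = TwistedProduct.mk _ _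
    congr 1
    · exact mul_assoc _ _ _
    · have := hc u.base v.base w.base
      change u.fiber + v.fiber + c u.base v.base + w.fiber + c (u.base * v.base) w.base =
        u.fiber + (v.fiber + w.fiber + c v.base w.base) + c u.base (v.base * w.base)
      linear_combination (norm := abel) -this
  zero_add u := by
    change TwistedProduct.mk (1 * u.base) (0 + u.fiber + c 1 u.base) = u
    rw [one_mul, zero_add, h1, add_zero]
  add_zero u := by
    change TwistedProduct.mk (u.base * 1) (u.fiber + 0 + c u.base 1) = u
    rw [mul_one, add_zero, hs, h1, add_zero]
  neg_add_cancel u := by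
    change TwistedProduct.mk (u.base⁻¹ * u.base)
      (-u.fiber - c u.base⁻¹ u.base + u.fiber + c u.base⁻¹ u.base) = ⟨1, 0⟩
    rw [inv_mul_cancel]
    congr 1
    abel
  add_comm u v := by
    change TwistedProduct.mk _ _ = TwistedProduct.mk _ _
    congr 1
    · exact mul_comm _ _
    · rw [hs, add_comm u.fiber]
  nsmul := nsmulRec
  zsmul := zsmulRec

/-- A symmetric 2-cocycle defines a commutative extension by `A`; since a divisible group is an
injective `ℤ`-module, this extension splits, and the cocycle is a coboundary. -/
theorem exists_eq_of_symmetric [DivisibleBy A ℤ] {c : G → G → A}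
    (hc : ∀ x y z, c y z - c (x * y) z + c x (y * z) - c x y = 0)
    (hs : ∀ x y, c x y = c y x) (h1 : ∀ x, c 1 x = 0) :
    ∃ β : G → A, ∀ x y, c x y = β x + β y - β (x * y) := by
  let _ := TwistedProduct.addCommGroup hc hs h1
  let i : A →+ TwistedProduct c :=
    { toFun a := ⟨1, a⟩
      map_zero' := rfl
      map_add' a b := by
        change TwistedProduct.mk 1 (a + b) = TwistedProduct.mk (1 * 1) (a + b + c 1 1)
        rw [one_mul, h1, add_zero] }
  have hi : Function.Injective i := fun a b h => congrArg TwistedProduct.fiber h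
  obtain ⟨r, hr⟩ := (Module.Baer.of_divisible A).extension_property_addMonoidHom i hi
    (AddMonoidHom.id A)
  refine ⟨fun x => r ⟨x, 0⟩, fun x y => ?_⟩
  have h2 : (⟨x, 0⟩ + ⟨y, 0⟩ : TwistedProduct c) = ⟨x * y, 0⟩ + i (c x y) := by
    change TwistedProduct.mk (x * y) (0 + 0 + c x y) =
      TwistedProduct.mk (x * y * 1) (0 + c x y + c (x * y) 1)
    rw [mul_one, hs (x * y), h1, add_zero, add_zero]
  have h3 := congrArg r h2
  have h4 : r (i (c x y)) = c x y := DFunLike.congr_fun hr _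
  rw [map_add, map_add, h4] at h3
  rw [h3]
  abel

end Symmetric

/-! ### Adjoining a cyclic factor -/

section Splitting

/-- A decomposition of `G` as the internal direct product of the subgroup `H` and the cyclic group
of order `m` generated by `g`: each `x` is `base x * g ^ exp x`, with `base x ∈ H` and
`exp x < m`. -/
structure CyclicSplitting {G : Type*} [CommGroup G] (H : Subgroup G) (g : G) (m : ℕ) where
  base : G →* G
  exp : G → ℕ
  base_mem : ∀ x, base x ∈ H
  base_of_mem : ∀ h ∈ H, base h = h
  base_mul_pow : ∀ x, base x * g ^ exp x = x
  exp_lt : ∀ x, exp x < m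
  exp_mul_of_mem : ∀ x, ∀ h ∈ H, exp (x * h) = exp x
  exp_pow : ∀ k < m, exp (g ^ k) = k
  pow_eq_one : g ^ m = 1

variable {G A : Type*} [CommGroup G] [AddCommGroup A] {H : Subgroup G} {g : G} {m : ℕ}

namespace CyclicSplitting

theorem pos (S : CyclicSplitting H g m) : 0 < m := (Nat.zero_le _).trans_lt (S.exp_lt 1)

theorem exp_of_mem (S : CyclicSplitting H g m) {h : G} (hh : h ∈ H) : S.exp h = 0 := by
  rw [← one_mul h, S.exp_mul_of_mem _ _ hh, ← pow_zero g, S.exp_pow _ S.pos]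

theorem pow_mod (S : CyclicSplitting H g m) (k : ℕ) : g ^ (k % m) = g ^ k := by
  conv_rhs => rw [← Nat.mod_add_div k m, pow_add, pow_mul, S.pow_eq_one, one_pow, mul_one]

theorem exp_mul (S : CyclicSplitting H g m) (y z : G) :
    S.exp (y * z) = (S.exp y + S.exp z) % m := by
  have h : y * z = g ^ ((S.exp y + S.exp z) % m) * (S.base y * S.base z) := by
    conv_lhs => rw [← S.base_mul_pow y, ← S.base_mul_pow z]
    rw [S.pow_mod, pow_add]
    ac_rfl
  rw [h, S.exp_mul_of_mem _ _ (H.mul_mem (S.base_mem y) (S.base_mem z)),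
    S.exp_pow _ (Nat.mod_lt _ S.pos)]

/-- If `f` vanishes on `H`, then it is cohomologous to a cocycle that vanishes as soon as its last
argument lies in `H`. -/
theorem exists_vanish_last (S : CyclicSplitting H g m) {f : G → G → G → A}
    (hf : delta3 f = 0) (hn : Normalized f)
    (hH : ∀ x ∈ H, ∀ y ∈ H, ∀ z ∈ H, f x y z = 0) :
    ∃ J, Normalized (f - delta2 J) ∧ ∀ x y, ∀ z ∈ H, (f - delta2 J) x y z = 0 := by
  -- On each coset `g ^ i * H` the cocycle condition exhibits `f x h₂ h₃` as a coboundary in `H`.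
  -- Removing the primitives found on the cosets makes `f x y z` vanish for `y, z ∈ H`.
  let J₁ : G → G → A := fun x y => f (g ^ S.exp x) (S.base x) y
  obtain ⟨f₁, hf₁⟩ : ∃ f₁, f₁ = f + delta2 J₁ := ⟨_, rfl⟩
  have hc₁ : delta3 f₁ = 0 := by rw [hf₁, map_add, hf, delta3_delta2, add_zero]
  have hn₁ : Normalized f₁ := hf₁ ▸ hn.add_delta2
    (fun y => by simp only [J₁, map_one, (hn _ _).2.1]) (fun x => (hn _ _).2.2)
  have h₁ : ∀ x, ∀ y ∈ H, ∀ z ∈ H, f₁ x y z = 0 := fun x y hy z hz => by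
    have key := cocycle_apply hf (g ^ S.exp x) (S.base x) y z
    rw [hH _ (S.base_mem x) _ hy _ hz, mul_comm (g ^ _), S.base_mul_pow] at key
    simp only [hf₁, Pi.add_apply, delta2_apply, J₁, S.exp_of_mem hy, pow_zero, (hn _ _).1,
      S.exp_mul_of_mem _ _ hy, map_mul, S.base_of_mem _ hy]
    linear_combination (norm := abel) -key
  -- Then `f₁ x (y * u) z = f₁ x y (u * z) - f₁ x y u` for `u, z ∈ H`. For `y = g ^ j` with `j < m`,
  -- this is the coboundary of `J₂` at `(x, y * u, z)`.
  let J₂ : G → G → A := fun x y => f₁ x (g ^ S.exp y) (S.base y)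
  have hJ₂ : ∀ x, ∀ z ∈ H, J₂ x z = 0 := fun x z hz => by
    simp only [J₂, S.exp_of_mem hz, pow_zero, (hn₁ _ _).2.1]
  have e : f - delta2 (J₂ - J₁) = f₁ + delta2 (-J₂) := by
    rw [hf₁, map_sub, map_neg]; abel
  refine ⟨J₂ - J₁, ?_, fun x y z hz => ?_⟩
  · rw [e]
    exact hn₁.add_delta2 (fun y => by simp [J₂, (hn₁ _ _).1])
      (fun x => by simp [hJ₂ x 1 H.one_mem])
  · have key := cocycle_apply hc₁ x (g ^ S.exp y) (S.base y) z
    rw [h₁ _ _ (S.base_mem y) _ hz, h₁ _ _ (S.base_mem y) _ hz, mul_comm (g ^ _),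
      S.base_mul_pow] at key
    rw [e]
    simp only [Pi.add_apply, map_neg, Pi.neg_apply, delta2_apply, hJ₂ _ _ hz]
    simp only [J₂, S.exp_mul_of_mem _ _ hz, map_mul, S.base_of_mem _ hz]
    linear_combination (norm := abel) key

/-- A cocycle that vanishes when its last argument is in `H` depends on it only modulo `H`. -/
theorem mul_last {f : G → G → G → A} (hf : delta3 f = 0)
    (h : ∀ x y, ∀ z ∈ H, f x y z = 0) (x y z : G) {u : G} (hu : u ∈ H) :
    f x y (z * u) = f x y z := by
  have key := cocycle_apply hf x y z u
  rw [h _ _ _ hu, h _ _ _ hu, h _ _ _ hu] at key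
  linear_combination (norm := abel) -key

/-- For `y ∈ H`, the function `z ↦ f x y z` is additive in `z` up to a coboundary in `(x, y)`. -/
theorem mul_last_eq {f : G → G → G → A} (hf : delta3 f = 0)
    (h : ∀ x y, ∀ z ∈ H, f x y z = 0) (x : G) {y : G} (hy : y ∈ H) (z w : G) :
    f x y (z * w) = f x y z + f x y w + ((f x z w - f z x w) + (f y z w - f z y w) -
      (f (x * y) z w - f z (x * y) w)) := by
  have h1 := cocycle_apply hf x y z w
  have h2 := cocycle_apply hf x z y w
  have h3 := cocycle_apply hf z x y w
  rw [mul_comm y w, mul_last hf h _ _ _ hy, h _ _ _ hy] at h2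
  rw [mul_comm y w, mul_last hf h _ _ _ hy, h _ _ _ hy] at h3
  simp only [mul_comm z x, mul_comm z y] at *
  linear_combination (norm := abel) -h1 + h2 - h3

/-- The `H`-part of the obstruction, a symmetric 2-cocycle on `H`, can be removed. -/
theorem exists_vanish_left (S : CyclicSplitting H g m) [DivisibleBy A ℤ]
    {f : G → G → G → A} (hf : delta3 f = 0)
    (hn : Normalized f) (h : ∀ x y, ∀ z ∈ H, f x y z = 0)
    (hsymm : ∀ x ∈ H, ∀ y ∈ H, f x y g = f y x g) :
    ∃ J : G → G → A, (∀ x y, ∀ z ∈ H, (f - delta2 J) x y z = 0) ∧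
      ∀ x ∈ H, ∀ y ∈ H, ∀ z, (f - delta2 J) x y z = 0 := by
  obtain ⟨β, hβ⟩ := exists_eq_of_symmetric (c := fun x y => f (S.base x) (S.base y) g)
    (fun x y z => by
      have key := cocycle_apply hf (S.base x) (S.base y) (S.base z) g
      rw [mul_comm _ g, mul_last hf h _ _ _ (S.base_mem z), h _ _ _ (S.base_mem z)] at key
      simp only [map_mul]
      linear_combination (norm := abel) key)
    (fun x y => hsymm _ (S.base_mem x) _ (S.base_mem y))
    (fun x => by simp only [map_one, (hn _ _).1])
  -- Since `f x y z` is additive in `z` up to an explicit coboundary, a primitive of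
  -- `(x, y) ↦ f x y (g ^ k)` on `H` is obtained by adding up `k` steps.
  let b : ℕ → G → A := fun k x =>
    k • β x + ∑ j ∈ Finset.range k, (f x (g ^ j) g - f (g ^ j) x g)
  have hb : ∀ x ∈ H, ∀ y ∈ H, ∀ k, f x y (g ^ k) = b k x + b k y - b k (x * y) :=
      fun x hx y hy k => by
    induction k with
    | zero => simp [b, (hn _ _).2.2]
    | succ k ih =>
      have h1 := hβ x y
      simp only [S.base_of_mem _ hx, S.base_of_mem _ hy] at h1
      rw [pow_succ, mul_last_eq hf h x hy, ih, h1]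
      simp only [b, succ_nsmul, Finset.sum_range_succ]
      abel
  have hJ₁ : ∀ x, ∀ z ∈ H, b (S.exp z) x = 0 := fun x z hz => by
    simp [S.exp_of_mem hz, b]
  refine ⟨fun x z => b (S.exp z) x, fun x y z hz => ?_, fun x hx y hy z => ?_⟩
  · simp only [Pi.sub_apply, delta2_apply, h _ _ _ hz, hJ₁ _ _ hz, S.exp_mul_of_mem _ _ hz]
    abel
  · have h1 : f x y z = f x y (g ^ S.exp z) := by
      rw [← mul_last hf h _ _ (g ^ S.exp z) (S.base_mem z), mul_comm (g ^ _), S.base_mul_pow]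
    simp only [Pi.sub_apply, delta2_apply, hJ₁ _ _ hy, mul_comm y z, S.exp_mul_of_mem _ _ hy]
    rw [h1, hb x hx y hy]
    abel

/-- If `f x y z` vanishes for `z ∈ H` and for `x, y ∈ H`, then, on each coset `g ^ i * H`, the
function `f x y z` of `x` and `y ∈ H` is a coboundary. -/
theorem exists_vanish_middle (S : CyclicSplitting H g m) {f : G → G → G → A} (hf : delta3 f = 0)
    (h : ∀ x y, ∀ z ∈ H, f x y z = 0) (h' : ∀ x ∈ H, ∀ y ∈ H, ∀ z, f x y z = 0) :
    ∃ J : G → G → A, (∀ x y, ∀ z ∈ H, (f - delta2 J) x y z = 0) ∧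
      ∀ x, ∀ y ∈ H, ∀ z, (f - delta2 J) x y z = 0 := by
  let J : G → G → A := fun x z => - f (g ^ S.exp x) (S.base x) z
  have hJ : ∀ x, ∀ z ∈ H, J x z = 0 := fun x z hz => by simp only [J, h _ _ _ hz, neg_zero]
  refine ⟨J, fun x y z hz => ?_, fun x y hy z => ?_⟩
  · simp only [Pi.sub_apply, delta2_apply, h _ _ _ hz, hJ _ _ hz]
    simp only [J, mul_last hf h _ _ _ hz]
    abel
  · have key := cocycle_apply hf (g ^ S.exp x) (S.base x) y z
    rw [h' _ (S.base_mem x) _ hy, mul_comm (g ^ _), S.base_mul_pow, mul_comm y z,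
      mul_last hf h _ _ _ hy, h _ _ _ hy] at key
    simp only [Pi.sub_apply, delta2_apply, hJ _ _ hy, mul_comm y z]
    simp only [J, mul_last hf h _ _ _ hy, S.exp_mul_of_mem _ _ hy, map_mul, S.base_of_mem _ hy,
      S.exp_of_mem hy, pow_zero, h' _ H.one_mem _ hy]
    linear_combination (norm := abel) -key

/-- If `f x y z` vanishes as soon as `y` or `z` lies in `H`, it depends only on `x` and on the
classes of `y` and `z` in the cyclic quotient. As for a cyclic group, it is then cohomologous to the
cup product of the homomorphism `φ x = ∑ f x (g ^ j) g` with the 2-cocycle of carries. -/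
theorem exists_eq_carry (S : CyclicSplitting H g m) {f : G → G → G → A} (hf : delta3 f = 0)
    (h : ∀ x y, ∀ z ∈ H, f x y z = 0) (h' : ∀ x, ∀ y ∈ H, ∀ z, f x y z = 0) :
    ∃ (J : G → G → A) (φ : G → A), (∀ x y, φ (x * y) = φ x + φ y) ∧
      f = delta2 J + fun x y z => ((S.exp y + S.exp z) / m) • φ x := by
  have hmul : ∀ x y z, ∀ u ∈ H, f x (y * u) z = f x y z := fun x y z u hu => by
    have key := cocycle_apply hf x y u z
    rw [h' _ _ hu, h' _ _ hu, mul_comm u z, mul_last hf h _ _ _ hu, h _ _ _ hu] at key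
    linear_combination (norm := abel) key
  let s : ℕ → G → A := fun k x => ∑ j ∈ Finset.range k, f x (g ^ j) g
  have hs : ∀ x y k, ∑ j ∈ Finset.range k, f x (y * g ^ j) g =
      s (S.exp y + k) x - s (S.exp y) x := fun x y k => by
    simp only [s]
    rw [Finset.sum_range_add, add_sub_cancel_left]
    refine Finset.sum_congr rfl fun j _ => ?_
    rw [← hmul x (g ^ (S.exp y + j)) g _ (S.base_mem y)]
    congr 1
    conv_lhs => rw [← S.base_mul_pow y]
    rw [pow_add]
    ac_rfl
  have hrec : ∀ x y k, f x y (g ^ k) = s k y - s k (x * y) + s (S.exp y + k) x -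
      s (S.exp y) x := fun x y k => by
    have h1 : s k y - s k (x * y) + ∑ j ∈ Finset.range k, f x (y * g ^ j) g = f x y (g ^ k) := by
      induction k with
      | zero => simp [s, h _ _ _ H.one_mem]
      | succ k ih =>
        have key := cocycle_apply hf x y (g ^ k) g
        simp only [s] at ih
        simp only [s, Finset.sum_range_succ]
        rw [pow_succ]
        linear_combination (norm := abel) ih + key
    rw [← h1, hs]
    abel
  have hper : ∀ k x, s (k + m) x = s k x + s m x := fun k x => by
    simp only [s]
    rw [add_comm k m, Finset.sum_range_add, add_comm]
    simp only [pow_add, S.pow_eq_one, one_mul]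
  have hcarry : ∀ k x, s k x = s (k % m) x + (k / m) • s m x := fun k x => by
    have : ∀ c r, s (r + m * c) x = s r x + c • s m x := fun c r => by
      induction c with
      | zero => simp
      | succ c ih => rw [mul_add, mul_one, ← add_assoc, hper, ih, succ_nsmul, add_assoc]
    rw [← this, Nat.mod_add_div]
  refine ⟨fun x z => s (S.exp z) x, s m, fun x y => ?_, ?_⟩
  · have h1 := hrec x y m
    rw [S.pow_eq_one, h _ _ _ H.one_mem, hper] at h1
    linear_combination (norm := abel) h1
  · funext x y z
    have h1 : f x y z = f x y (g ^ S.exp z) := by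
      rw [← mul_last hf h _ _ (g ^ S.exp z) (S.base_mem z), mul_comm (g ^ _), S.base_mul_pow]
    rw [h1, hrec]
    simp only [Pi.add_apply, delta2_apply, S.exp_mul]
    rw [hcarry (S.exp y + S.exp z)]
    abel

/-- A cocycle on `H × ⟨g⟩` that vanishes on `H` and has trivial antisymmetrization is, up to a
coboundary, the cup product of a homomorphism with the 2-cocycle of carries of `⟨g⟩`. -/
theorem exists_eq_delta2_add_carry (S : CyclicSplitting H g m) [DivisibleBy A ℤ]
    {f : G → G → G → A} (hf : delta3 f = 0)
    (hH : ∀ x ∈ H, ∀ y ∈ H, ∀ z ∈ H, f x y z = 0) (hn : Normalized f)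
    (halt : ∀ x y, altInv x y g f = 0) :
    ∃ (J : G → G → A) (φ : G → A), (∀ x y, φ (x * y) = φ x + φ y) ∧
      f = delta2 J + fun x y z => ((S.exp y + S.exp z) / m) • φ x := by
  have hc : ∀ {f : G → G → G → A} (J), delta3 f = 0 → delta3 (f - delta2 J) = 0 :=
    fun J hf => by rw [map_sub, hf, delta3_delta2, sub_zero]
  obtain ⟨J₁, hn₁, h₁⟩ := S.exists_vanish_last hf hn hH
  have hsymm : ∀ x ∈ H, ∀ y ∈ H, (f - delta2 J₁) x y g = (f - delta2 J₁) y x g :=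
      fun x hx y hy => by
    have key : altInv x y g (f - delta2 J₁) = 0 := by
      rw [map_sub, halt, altInv_delta2, sub_zero]
    simp only [altInv_apply, slant_apply, h₁ _ _ _ hx, h₁ _ _ _ hy] at key
    linear_combination (norm := abel) key
  obtain ⟨J₂, h₂, h₂'⟩ := S.exists_vanish_left (hc J₁ hf) hn₁ h₁ hsymm
  obtain ⟨J₃, h₃, h₃'⟩ := S.exists_vanish_middle (hc J₂ (hc J₁ hf)) h₂ h₂'
  obtain ⟨J, φ, hφ, e⟩ := S.exists_eq_carry (hc J₃ (hc J₂ (hc J₁ hf))) h₃ h₃'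
  refine ⟨J + J₁ + J₂ + J₃, φ, hφ, ?_⟩
  rw [sub_eq_iff_eq_add, sub_eq_iff_eq_add, sub_eq_iff_eq_add] at e
  rw [e, map_add, map_add, map_add]
  abel

end CyclicSplitting
end Splitting

/-! ### Cup products with the 2-cocycle of carries -/

section Carry

variable {G A : Type*} [CommGroup G] [AddCommGroup A]

/-- The cup product of `φ` with the 2-cocycle of carries of the coordinate `κ` modulo `m`. -/
def cupCarry (φ : G → A) (κ : G → ℕ) (m : ℕ) : G → G → G → A :=
  fun x y z => ((κ y + κ z) / m) • φ x

/-- The number of carries modulo `m` in the coordinate `κ` when `h` is added `q` times. -/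
def carrySum (κ : G → ℕ) (m : ℕ) (h : G) (q : ℕ) : ℕ :=
  ∑ j ∈ Finset.range q, (κ (h ^ j) + κ h) / m

theorem slant_cupCarry (φ : G → A) (κ : G → ℕ) (m : ℕ) (g x y : G) :
    slant g (cupCarry φ κ m) x y = ((κ x + κ y) / m) • φ g := by
  simp only [slant_apply, cupCarry, add_comm (κ g)]
  abel

theorem slantSum_cupCarry (φ : G → A) (κ : G → ℕ) (m : ℕ) (g h : G) (q : ℕ) :
    slantSum g h q (cupCarry φ κ m) = carrySum κ m h q • φ g := by
  simp only [slantSum_apply, slant_cupCarry, carrySum, Finset.sum_smul]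

theorem cyclicInv_cupCarry (φ : G → A) (κ : G → ℕ) (m : ℕ) (g : G) (q : ℕ) :
    cyclicInv g q (cupCarry φ κ m) = carrySum κ m g q • φ g := by
  simp only [cyclicInv_apply, cupCarry, carrySum, Finset.sum_smul]

/-- The 2-cocycle of carries is symmetric. -/
theorem altInv_cupCarry (φ : G → A) (κ : G → ℕ) (m : ℕ) (x y z : G) :
    altInv x y z (cupCarry φ κ m) = 0 := by
  rw [altInv_apply, slant_cupCarry, slant_cupCarry, add_comm (κ y), sub_self]

variable {κ : G → ℕ} {m : ℕ}

/-- The remainders `κ (h ^ j)` return to their initial value after `q` steps, so that the carries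
account for the whole of `q * κ h`. -/
theorem mul_carrySum (hκ : ∀ x y, κ (x * y) = (κ x + κ y) % m) {h : G} {q : ℕ} (hh : h ^ q = 1) :
    m * carrySum κ m h q = q * κ h := by
  have h1 := sum_range_pow_sub_pow_succ (fun x => (κ x : ℤ)) hh
  have h2 : ∀ j, ((κ (h ^ j) : ℤ) - κ (h ^ (j + 1))) =
      m * ((κ (h ^ j) + κ h) / m : ℕ) - κ h := fun j => by
    have := Nat.mod_add_div (κ (h ^ j) + κ h) m
    rw [pow_succ, hκ]
    zify at this
    push_cast
    linear_combination -this
  simp only [h2, Finset.sum_sub_distrib, Finset.sum_const, Finset.card_range] at h1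
  zify [carrySum]
  rw [Finset.mul_sum]
  push_cast at h1 ⊢
  linear_combination h1

theorem carrySum_of_eq_zero (hm : 0 < m) (hκ : ∀ x y, κ (x * y) = (κ x + κ y) % m) {h : G} {q : ℕ}
    (hh : h ^ q = 1) (h0 : κ h = 0) : carrySum κ m h q = 0 := by
  have := mul_carrySum hκ hh
  rw [h0, mul_zero] at this
  exact (Nat.mul_eq_zero.mp this).resolve_left hm.ne'

theorem carrySum_self (hm : 0 < m) (hκ : ∀ x y, κ (x * y) = (κ x + κ y) % m) {h : G}
    (hh : h ^ m = 1) : carrySum κ m h m = κ h :=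
  Nat.eq_of_mul_eq_mul_left hm (mul_carrySum hκ hh)

theorem delta3_cupCarry (hκ : ∀ x y, κ (x * y) = (κ x + κ y) % m) {φ : G → A}
    (hφ : ∀ x y, φ (x * y) = φ x + φ y) (hm : 0 < m) : delta3 (cupCarry φ κ m) = 0 := by
  funext x y z w
  have h : (κ z + κ w) / m + (κ y + κ (z * w)) / m = (κ (y * z) + κ w) / m + (κ y + κ z) / m := by
    apply Nat.eq_of_mul_eq_mul_left hm
    have h1 := Nat.mod_add_div (κ z + κ w) m
    have h2 := Nat.mod_add_div (κ y + κ (z * w)) m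
    have h3 := Nat.mod_add_div (κ (y * z) + κ w) m
    have h4 := Nat.mod_add_div (κ y + κ z) m
    have h5 : κ (y * (z * w)) = κ (y * z * w) := by rw [mul_assoc]
    rw [hκ, hκ (y * z)] at h5
    rw [← hκ] at h1 h4
    rw [mul_add, mul_add]
    omega
  have h' := congrArg (· • φ x) h
  simp only [add_smul] at h'
  simp only [delta3, AddMonoidHom.coe_mk, ZeroHom.coe_mk, cupCarry, hφ, smul_add, Pi.zero_apply]
  linear_combination (norm := abel) -h'

/-- If `φ` is divisible by `m` among homomorphisms, its cup product with the carries modulo `m` is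
a coboundary. -/
theorem cupCarry_nsmul (hκ : ∀ x y, κ (x * y) = (κ x + κ y) % m) {ψ : G → A}
    (hψ : ∀ x y, ψ (x * y) = ψ x + ψ y) :
    cupCarry (fun x => m • ψ x) κ m = delta2 (fun x z => -(κ z • ψ x)) := by
  funext x y z
  have h := congrArg (· • ψ x) (Nat.mod_add_div (κ y + κ z) m)
  rw [← hκ] at h
  simp only [add_smul, mul_comm m, mul_smul] at h
  simp only [cupCarry, delta2_apply, hψ, smul_add]
  linear_combination (norm := abel) h

end Carry

/-! ### Coordinates on a product of cyclic groups -/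

section Coordinates

variable {G A : Type*} [CommGroup G] [AddCommGroup A] {n : ℕ} {m : Fin n → ℕ}

/-- The generator of the `l`-th cyclic factor. -/
def gen (e : G ≃* ∀ l : Fin n, Multiplicative (ZMod (m l))) (l : Fin n) : G :=
  e.symm (Pi.mulSingle l (Multiplicative.ofAdd 1))

variable (e : G ≃* ∀ l : Fin n, Multiplicative (ZMod (m l)))

theorem expo_mul (hm : ∀ l, 0 < m l) (l : Fin n) (x y : G) :
    expo e l (x * y) = (expo e l x + expo e l y) % m l := by
  have : NeZero (m l) := ⟨(hm l).ne'⟩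
  simp only [expo, map_mul, Pi.mul_apply, toAdd_mul, ZMod.val_add]

theorem expo_one (l : Fin n) : expo e l 1 = 0 := by
  simp [expo]

theorem expo_gen_self (l : Fin n) : expo e l (gen e l) = 1 % m l := by
  simp [expo, gen, ZMod.val_one_eq_one_mod]

theorem expo_gen_of_ne {l s : Fin n} (h : l ≠ s) : expo e l (gen e s) = 0 := by
  simp [expo, gen, h]

theorem gen_pow (l : Fin n) : gen e l ^ m l = 1 := by
  rw [gen, ← map_pow, ← Pi.mulSingle_pow, ← ofAdd_nsmul]
  simp

theorem eq_prod_gen_pow (hm : ∀ l, 0 < m l) (x : G) : x = ∏ l, gen e l ^ expo e l x := by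
  apply e.injective
  rw [map_prod, ← Finset.univ_prod_mulSingle (e x)]
  refine Finset.prod_congr rfl fun l _ => ?_
  have : NeZero (m l) := ⟨(hm l).ne'⟩
  rw [gen, map_pow, e.apply_symm_apply, ← Pi.mulSingle_pow, ← ofAdd_nsmul, expo]
  simp

theorem eq_sum_gen (hm : ∀ l, 0 < m l) {φ : G → A} (hφ : ∀ x y, φ (x * y) = φ x + φ y) (x : G) :
    φ x = ∑ l, expo e l x • φ (gen e l) := by
  let F : G →* Multiplicative A := MonoidHom.mk' (fun x => Multiplicative.ofAdd (φ x)) hφ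
  have h := congrArg F (eq_prod_gen_pow e hm x)
  simp only [map_prod, map_pow] at h
  exact h

theorem map_one_eq_zero {φ : G → A} (hφ : ∀ x y, φ (x * y) = φ x + φ y) : φ 1 = 0 := by
  have := hφ 1 1
  rwa [mul_one, left_eq_add] at this

theorem map_pow_eq_nsmul {φ : G → A} (hφ : ∀ x y, φ (x * y) = φ x + φ y) (x : G) (k : ℕ) :
    φ (x ^ k) = k • φ x := by
  induction k with
  | zero => simp [map_one_eq_zero hφ]
  | succ k ih => rw [pow_succ, hφ, ih, succ_nsmul]

theorem nsmul_mod {k : ℕ} {w : A} (hw : k • w = 0) (a : ℕ) : (a % k) • w = a • w := by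
  conv_rhs => rw [← Nat.mod_add_div a k, add_smul, mul_comm, mul_smul, hw, smul_zero, add_zero]

theorem expo_mul_nsmul (hm : ∀ l, 0 < m l) (l : Fin n) {w : A} (hw : m l • w = 0) (x y : G) :
    expo e l (x * y) • w = expo e l x • w + expo e l y • w := by
  rw [expo_mul e hm, nsmul_mod hw, add_smul]

/-- This covers the degenerate factors: the coordinate of the generator is `1 % k`, which is `0`
when `k = 1`. -/
theorem eq_zero_of_one_mod_nsmul {k : ℕ} {a : A} (h : (1 % k) • a = 0) (h' : k • a = 0) :
    a = 0 := by
  rwa [nsmul_mod h', one_smul] at h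

theorem altInv_eq_zero (hm : ∀ l, 0 < m l) {f : G → G → G → A} (hf : delta3 f = 0)
    (h : ∀ r s t : Fin n, r < s → s < t → altInv (gen e r) (gen e s) (gen e t) f = 0)
    (x y z : G) : altInv x y z f = 0 := by
  have ext : ∀ y z, (∀ l, altInv (gen e l) y z f = 0) → ∀ x, altInv x y z f = 0 := fun y z H x => by
    rw [eq_sum_gen e hm (φ := fun x => altInv x y z f) (fun x x' => altInv_mul hf x x' y z)]
    simp [H]
  have hs : ∀ x y z, altInv x y z f = 0 → altInv y x z f = 0 := fun x y z H => by
    rw [altInv_swap, H, neg_zero]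
  have hr : ∀ x y z, altInv x y z f = 0 → altInv y z x f = 0 := fun x y z H => by
    rw [← altInv_rotate, H]
  have hgen : ∀ r s t : Fin n, altInv (gen e r) (gen e s) (gen e t) f = 0 := fun r s t => by
    rcases lt_trichotomy r s with h1 | rfl | h1
    · rcases lt_trichotomy s t with h2 | rfl | h2
      · exact h _ _ _ h1 h2
      · exact hr _ _ _ (hr _ _ _ (altInv_self _ _ f))
      · rcases lt_trichotomy r t with h3 | rfl | h3
        · exact hr _ _ _ (hs _ _ _ (h _ _ _ h3 h2))
        · exact hr _ _ _ (altInv_self _ _ f)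
        · exact hr _ _ _ (h _ _ _ h3 h1)
    · exact altInv_self _ _ f
    · rcases lt_trichotomy r t with h2 | rfl | h2
      · exact hs _ _ _ (h _ _ _ h1 h2)
      · exact hr _ _ _ (altInv_self _ _ f)
      · rcases lt_trichotomy s t with h3 | rfl | h3
        · exact hr _ _ _ (hr _ _ _ (h _ _ _ h3 h2))
        · exact hr _ _ _ (hr _ _ _ (altInv_self _ _ f))
        · exact hr _ _ _ (hs _ _ _ (hr _ _ _ (hr _ _ _ (h _ _ _ h3 h1))))
  refine ext _ _ (fun r => hr _ _ _ (hr _ _ _ (ext _ _ (fun s => hr _ _ _ (hr _ _ _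
    (ext _ _ (fun t => hgen t r s) z))) y))) x

end Coordinates

/-! ### Cocycles with trivial invariants -/

section Vanishing

variable {G A : Type*} [CommGroup G] [AddCommGroup A]

/-- A 2-cochain whose coboundary is normalized is constant on the axes, and subtracting this
constant does not change the coboundary. -/
theorem exists_normalized_of_delta2 {J : G → G → A} (hJ : Normalized (delta2 J)) :
    ∃ J', delta2 J' = delta2 J ∧ (∀ y, J' 1 y = 0) ∧ ∀ x, J' x 1 = 0 := by
  refine ⟨fun x y => J x y - J 1 1, ?_, fun y => ?_, fun x => ?_⟩
  · funext x y z
    simp only [delta2_apply]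
    abel
  · have := (hJ 1 y).1
    simp only [delta2_apply, one_mul] at this
    beta_reduce
    linear_combination (norm := abel) this
  · have := (hJ x 1).2.2
    simp only [delta2_apply, mul_one] at this
    beta_reduce
    linear_combination (norm := abel) -this

variable {n : ℕ}

/-- The inclusion of the product of the last `n` factors. -/
def tailInclusion (m : Fin (n + 1) → ℕ) : (∀ l : Fin n, Multiplicative (ZMod (m l.succ))) →*
    ∀ l : Fin (n + 1), Multiplicative (ZMod (m l)) where
  toFun x := Fin.cons 1 x
  map_one' := by ext l; refine Fin.cases ?_ (fun l => ?_) l <;> simp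
  map_mul' x y := by ext l; refine Fin.cases ?_ (fun l => ?_) l <;> simp

/-- The projection onto the product of the last `n` factors. -/
def tailProjection (m : Fin (n + 1) → ℕ) : (∀ l : Fin (n + 1), Multiplicative (ZMod (m l))) →*
    ∀ l : Fin n, Multiplicative (ZMod (m l.succ)) where
  toFun x l := x l.succ
  map_one' := rfl
  map_mul' _ _ := rfl

theorem tailInclusion_gen (m : Fin (n + 1) → ℕ) (l : Fin n) :
    tailInclusion m (gen (MulEquiv.refl _) l) = gen (MulEquiv.refl _) l.succ := by
  ext i
  refine Fin.cases ?_ (fun i => ?_) i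
  · simp [tailInclusion, gen]
  · by_cases h : i = l
    · subst h; simp [tailInclusion, gen]
    · simp [tailInclusion, gen, h]

/-- The splitting of a product of cyclic groups into its first factor and the others. -/
def tailSplitting (m : Fin (n + 1) → ℕ) (hm : ∀ l, 0 < m l) :
    CyclicSplitting
      (MonoidHom.ker (Pi.evalMonoidHom (fun l : Fin (n + 1) => Multiplicative (ZMod (m l))) 0))
      (gen (MulEquiv.refl _) 0) (m 0) where
  base := (tailInclusion m).comp (tailProjection m)
  exp := expo (MulEquiv.refl _) 0
  base_mem x := rfl
  base_of_mem h hh := by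
    ext l
    refine Fin.cases ?_ (fun l => ?_) l
    · exact (congrArg _ hh).symm
    · rfl
  base_mul_pow x := by
    have : NeZero (m 0) := ⟨(hm 0).ne'⟩
    ext l
    refine Fin.cases ?_ (fun l => ?_) l
    · simp [tailInclusion, gen, expo]
    · simp [tailInclusion, tailProjection, gen]
  exp_lt x := by
    have : NeZero (m 0) := ⟨(hm 0).ne'⟩
    exact ZMod.val_lt _
  exp_mul_of_mem x h hh := by
    have h0 : h 0 = 1 := hh
    simp [expo, h0]
  exp_pow k hk := by
    have : NeZero (m 0) := ⟨(hm 0).ne'⟩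
    simp [expo, gen, ZMod.val_natCast, Nat.mod_eq_of_lt hk]
  pow_eq_one := gen_pow _ _

/-- A cocycle all of whose invariants vanish is a coboundary. The hypothesis `hA` is what it takes
to divide a homomorphism from a product of cyclic groups to `A` by an integer among homomorphisms,
one generator at a time. -/
theorem exists_eq_delta2 [DivisibleBy A ℤ]
    (hA : ∀ p q : ℕ, 0 < p → ∀ a : A, (p / p.gcd q) • a = 0 → ∃ w, p • w = 0 ∧ q • w = a) :
    ∀ {n : ℕ} (m : Fin n → ℕ), (∀ l, 0 < m l) →
    ∀ f : (∀ l, Multiplicative (ZMod (m l))) → (∀ l, Multiplicative (ZMod (m l))) →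
      (∀ l, Multiplicative (ZMod (m l))) → A, delta3 f = 0 →
    (∀ l, cyclicInv (gen (MulEquiv.refl _) l) (m l) f = 0) →
    (∀ s t, s < t →
      pairInv (gen (MulEquiv.refl _) s) (gen (MulEquiv.refl _) t) (m s) (m t) f = 0) →
    (∀ x y z, altInv x y z f = 0) → ∃ J, f = delta2 J := by
  intro n
  induction n with
  | zero =>
    intro m _ f hf _ _ _
    obtain ⟨J, hJ⟩ := exists_normalized hf
    refine ⟨J, sub_eq_zero.mp ?_⟩
    funext x y z
    rw [Subsingleton.elim x 1]
    exact (hJ y z).1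
  | succ n ih =>
    intro m hm f₀ hf₀ h1 h2 h3
    obtain ⟨J₀, hn₀⟩ := exists_normalized hf₀
    obtain ⟨f, hff⟩ : ∃ f, f = f₀ - delta2 J₀ := ⟨_, rfl⟩
    rw [← hff] at hn₀
    have hf : delta3 f = 0 := by rw [hff, map_sub, hf₀, delta3_delta2, sub_zero]
    replace h1 : ∀ l, cyclicInv (gen (MulEquiv.refl _) l) (m l) f = 0 := fun l => by
      rw [hff, map_sub, h1, cyclicInv_delta2 _ (gen_pow _ _), sub_zero]
    replace h2 : ∀ s t, s < t → pairInv (gen (MulEquiv.refl _) s) (gen (MulEquiv.refl _) t)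
        (m s) (m t) f = 0 := fun s t hst => by
      rw [hff, map_sub, h2 _ _ hst, pairInv_delta2 _ (gen_pow _ _) (gen_pow _ _), sub_zero]
    replace h3 : ∀ x y z, altInv x y z f = 0 := fun x y z => by
      rw [hff, map_sub, h3, altInv_delta2, sub_zero]
    let ι := tailInclusion m
    let π := tailProjection m
    obtain ⟨J₁, hJ₁⟩ := ih (fun l => m l.succ) (fun l => hm _) (fun x y z => f (ι x) (ι y) (ι z))
      (by
        funext x y z w
        have := cocycle_apply hf (ι x) (ι y) (ι z) (ι w)
        simp only [← map_mul] at this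
        exact this)
      (fun l => by
        have := h1 l.succ
        rw [← tailInclusion_gen] at this
        simp only [cyclicInv_apply, ← map_pow] at this
        exact this)
      (fun s t hst => by
        have := h2 s.succ t.succ (Fin.succ_lt_succ_iff.mpr hst)
        rw [← tailInclusion_gen, ← tailInclusion_gen] at this
        simp only [pairInv_apply, slantSum_apply, ← map_pow] at this
        exact this)
      (fun x y z => h3 (ι x) (ι y) (ι z))
    have hn₁ : Normalized (delta2 J₁) := hJ₁ ▸ fun x y => by
      simp only [map_one]
      exact hn₀ _ _
    obtain ⟨J₂, hJ₂, hl, hr⟩ := exists_normalized_of_delta2 hn₁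
    -- The primitive on the product of the last factors, inflated to the whole group.
    obtain ⟨K, hK⟩ : ∃ K, K = fun x y => -J₂ (π x) (π y) := ⟨_, rfl⟩
    let S := tailSplitting m hm
    obtain ⟨J, φ, hφ, e⟩ := S.exists_eq_delta2_add_carry (f := f + delta2 K)
      (by rw [map_add, hf, delta3_delta2, zero_add])
      (fun x hx y hy z hz => by
        rw [← S.base_of_mem x hx, ← S.base_of_mem y hy, ← S.base_of_mem z hz]
        have := congrFun (congrFun (congrFun (hJ₁.trans hJ₂.symm) (π x)) (π y)) (π z)
        change f (ι (π x)) (ι (π y)) (ι (π z)) + delta2 K (ι (π x)) (ι (π y)) (ι (π z)) = 0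
        rw [this, hK]
        change delta2 J₂ (π x) (π y) (π z) + (-J₂ (π y) (π z) - -J₂ (π x * π y) (π z) +
          -J₂ (π x) (π y * π z) - -J₂ (π x) (π y)) = 0
        rw [delta2_apply]
        abel)
      (hn₀.add_delta2 (fun y => by rw [hK]; simp [hl]) (fun x => by rw [hK]; simp [hr]))
      (fun x y => by rw [map_add, h3, altInv_delta2, zero_add])
    obtain ⟨κ, hκ⟩ : ∃ κ : (∀ l, Multiplicative (ZMod (m l))) → ℕ,
      κ = expo (MulEquiv.refl _) 0 := ⟨_, rfl⟩
    replace e : f = delta2 (J - K) + cupCarry φ κ (m 0) := by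
      rw [map_sub, hκ]
      have e' : f + delta2 K = delta2 J + cupCarry φ (expo (MulEquiv.refl _) 0) (m 0) := e
      rw [eq_sub_of_add_eq e']
      abel
    have hκm : ∀ x y, κ (x * y) = (κ x + κ y) % m 0 := hκ ▸ expo_mul _ hm 0
    have hcs : carrySum κ (m 0) (gen (MulEquiv.refl _) 0) (m 0) = 1 % m 0 := by
      rw [carrySum_self (hm 0) hκm (gen_pow _ _), hκ, expo_gen_self]
    have hmφ : ∀ l, m l • φ (gen (MulEquiv.refl _) l) = 0 := fun l => by
      rw [← map_pow_eq_nsmul hφ, gen_pow, map_one_eq_zero hφ]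
    have hφ0 : φ (gen (MulEquiv.refl _) 0) = 0 := by
      have := h1 0
      rw [e, map_add, cyclicInv_delta2 _ (gen_pow _ _), zero_add, cyclicInv_cupCarry, hcs] at this
      exact eq_zero_of_one_mod_nsmul this (hmφ 0)
    -- As `φ` vanishes on the generator of the first factor, only one half of `pairInv` survives.
    have hφs : ∀ s : Fin n, ∃ w, m s.succ • w = 0 ∧
        m 0 • w = φ (gen (MulEquiv.refl _) s.succ) := fun s => by
      apply hA _ _ (hm _)
      have := h2 0 s.succ (Fin.succ_pos s)
      rw [e, map_add, pairInv_delta2 _ (gen_pow _ _) (gen_pow _ _), zero_add, pairInv_apply,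
        slantSum_cupCarry, slantSum_cupCarry, hφ0, smul_zero, smul_zero, zero_add, hcs,
        smul_comm, Nat.gcd_comm] at this
      refine eq_zero_of_one_mod_nsmul this ?_
      rw [smul_smul, mul_comm, div_gcd_mul, mul_smul, hmφ, smul_zero]
    choose w hw hw' using hφs
    obtain ⟨ψ, hψ⟩ : ∃ ψ : (∀ l, Multiplicative (ZMod (m l))) → A,
      ψ = fun x => ∑ s : Fin n, expo (MulEquiv.refl _) s.succ x • w s := ⟨_, rfl⟩
    have hψm : ∀ x y, ψ (x * y) = ψ x + ψ y := fun x y => by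
      simp only [hψ, ← Finset.sum_add_distrib]
      exact Finset.sum_congr rfl fun s _ => expo_mul_nsmul _ hm _ (hw s) _ _
    have hφψ : φ = fun x => m 0 • ψ x := by
      funext x
      rw [eq_sum_gen (MulEquiv.refl _) hm hφ, Fin.sum_univ_succ, hφ0, smul_zero, zero_add, hψ,
        Finset.smul_sum]
      refine Finset.sum_congr rfl fun s _ => ?_
      rw [← hw', smul_comm]
    refine ⟨J₀ + (J - K) + fun x z => -(κ z • ψ x), ?_⟩
    rw [map_add, map_add, ← cupCarry_nsmul hκm hψm, ← hφψ, add_assoc, ← e, hff]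
    abel

end Vanishing

/-! ### The standard cocycles -/

section Standard

variable {G A : Type*} [CommGroup G] [AddCommGroup A] {n : ℕ} {m : Fin n → ℕ}
  (e : G ≃* ∀ l : Fin n, Multiplicative (ZMod (m l)))

/-- The 3-cochain `(x, y, z) ↦ k_r j_s i_t w`, where `i`, `j`, `k` are the coordinates of `x`, `y`,
`z`. -/
def triple (p : Triples n) (w : A) : G → G → G → A :=
  fun x y z => expo e p.1.1 z • expo e p.1.2.1 y • expo e p.1.2.2 x • w

/-- The cochain `Φ`, for a coefficient group written additively, with arbitrary elements
`w₁ l`, `w₂ (s, t)`, `w₃ (r, s, t)` as coefficients. -/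
def standard (w₁ : Fin n → A) (w₂ : Pairs n → A) (w₃ : Triples n → A) : G → G → G → A :=
  ∑ l, cupCarry (fun x => expo e l x • w₁ l) (expo e l) (m l) +
  ∑ p : Pairs n, cupCarry (fun x => expo e p.1.2 x • w₂ p) (expo e p.1.1) (m p.1.1) -
  ∑ p : Triples n, triple e p (w₃ p)

theorem expo_gen_pow_of_ne (hm : ∀ l, 0 < m l) {l s : Fin n} (h : l ≠ s) (k : ℕ) :
    expo e l (gen e s ^ k) = 0 := by
  induction k with
  | zero => rw [pow_zero, expo_one]
  | succ k ih => rw [pow_succ, expo_mul e hm, ih, expo_gen_of_ne e h, Nat.zero_mod]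

theorem nsmul_eq_zero_of_dvd {p q : ℕ} (h : p ∣ q) {w : A} (hw : p • w = 0) : q • w = 0 :=
  addOrderOf_dvd_iff_nsmul_eq_zero.mp ((addOrderOf_dvd_iff_nsmul_eq_zero.mpr hw).trans h)

theorem delta3_triple (hm : ∀ l, 0 < m l) (p : Triples n) {w : A} (hw : gcd3 m p • w = 0) :
    delta3 (triple e p w) = 0 := by
  have h1 : m p.1.1 • w = 0 :=
    nsmul_eq_zero_of_dvd ((Nat.gcd_dvd_left _ _).trans (Nat.gcd_dvd_left _ _)) hw
  have h2 : m p.1.2.1 • w = 0 :=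
    nsmul_eq_zero_of_dvd ((Nat.gcd_dvd_left _ _).trans (Nat.gcd_dvd_right _ _)) hw
  have h3 : m p.1.2.2 • w = 0 := nsmul_eq_zero_of_dvd (Nat.gcd_dvd_right _ _) hw
  funext x y z t
  have e1 : ∀ x y z z', triple e p w x y (z * z') = triple e p w x y z + triple e p w x y z' :=
    fun x y z z' => expo_mul_nsmul e hm _
      (by rw [smul_comm, smul_comm (m p.1.1), h1, smul_zero, smul_zero]) _ _
  have e2 : ∀ x y y' z, triple e p w x (y * y') z = triple e p w x y z + triple e p w x y' z :=
    fun x y y' z => by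
      simp only [triple]
      rw [expo_mul_nsmul e hm _ (by rw [smul_comm, h2, smul_zero]), smul_add]
  have e3 : ∀ x x' y z, triple e p w (x * x') y z = triple e p w x y z + triple e p w x' y z :=
    fun x x' y z => by
      simp only [triple]
      rw [expo_mul_nsmul e hm _ h3, smul_add, smul_add]
  simp only [delta3, AddMonoidHom.coe_mk, ZeroHom.coe_mk, e1, e2, e3, Pi.zero_apply]
  abel

theorem triple_gen_pow (hm : ∀ l, 0 < m l) (p : Triples n) (w : A) {a b c : Fin n}
    (h : c ≠ p.1.1 ∨ b ≠ p.1.2.1 ∨ a ≠ p.1.2.2) (i j k : ℕ) :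
    triple e p w (gen e a ^ i) (gen e b ^ j) (gen e c ^ k) = 0 := by
  rw [triple]
  rcases h with h | h | h <;> rw [expo_gen_pow_of_ne e hm h.symm] <;> simp

theorem triple_gen (hm : ∀ l, 0 < m l) (p : Triples n) (w : A) {a b c : Fin n}
    (h : c ≠ p.1.1 ∨ b ≠ p.1.2.1 ∨ a ≠ p.1.2.2) :
    triple e p w (gen e a) (gen e b) (gen e c) = 0 := by
  simpa using triple_gen_pow e hm p w h 1 1 1

theorem cyclicInv_triple (hm : ∀ l, 0 < m l) (p : Triples n) (w : A) (l : Fin n) (q : ℕ) :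
    cyclicInv (gen e l) q (triple e p w) = 0 := by
  rw [cyclicInv_apply]
  refine Finset.sum_eq_zero fun j _ => ?_
  have := p.2
  simpa using triple_gen_pow e hm p w (a := l) (b := l) (c := l) (by lia) 1 j 1

theorem slantSum_triple (hm : ∀ l, 0 < m l) (p : Triples n) (w : A) (a b : Fin n) (q : ℕ) :
    slantSum (gen e a) (gen e b) q (triple e p w) = 0 := by
  rw [slantSum_apply]
  refine Finset.sum_eq_zero fun j _ => ?_
  have := p.2
  have h1 := triple_gen_pow e hm p w (a := a) (b := b) (c := b) (by lia) 1 j 1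
  have h2 := triple_gen_pow e hm p w (a := b) (b := a) (c := b) (by lia) j 1 1
  have h3 := triple_gen_pow e hm p w (a := b) (b := b) (c := a) (by lia) j 1 1
  rw [pow_one, pow_one] at h1 h2 h3
  rw [slant_apply, h1, h2, h3]
  simp

theorem altInv_triple_of_ne (hm : ∀ l, 0 < m l) (p p' : Triples n) (h : p ≠ p') (w : A) :
    altInv (gen e p'.1.1) (gen e p'.1.2.1) (gen e p'.1.2.2) (triple e p w) = 0 := by
  obtain ⟨⟨r, s, t⟩, h1, h2⟩ := p
  obtain ⟨⟨r', s', t'⟩, h1', h2'⟩ := p'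
  have hne : ¬ (r = r' ∧ s = s' ∧ t = t') := fun ⟨a, b, c⟩ => h (by subst a b c; rfl)
  simp only at h1 h2 h1' h2'
  simp only [altInv_apply, slant_apply]
  repeat rw [triple_gen e hm _ w (by simp only; lia)]
  simp

theorem altInv_triple (hm : ∀ l, 0 < m l) (p : Triples n) {w : A} (hw : gcd3 m p • w = 0) :
    altInv (gen e p.1.1) (gen e p.1.2.1) (gen e p.1.2.2) (triple e p w) = -w := by
  have h1 : m p.1.1 • w = 0 :=
    nsmul_eq_zero_of_dvd ((Nat.gcd_dvd_left _ _).trans (Nat.gcd_dvd_left _ _)) hw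
  have h2 : m p.1.2.1 • w = 0 :=
    nsmul_eq_zero_of_dvd ((Nat.gcd_dvd_left _ _).trans (Nat.gcd_dvd_right _ _)) hw
  have h3 : m p.1.2.2 • w = 0 := nsmul_eq_zero_of_dvd (Nat.gcd_dvd_right _ _) hw
  have h0 : triple e p w (gen e p.1.2.2) (gen e p.1.2.1) (gen e p.1.1) = w := by
    rw [triple, expo_gen_self, expo_gen_self, expo_gen_self, nsmul_mod h3, one_smul,
      nsmul_mod h2, one_smul, nsmul_mod h1, one_smul]
  obtain ⟨⟨r, s, t⟩, h4, h5⟩ := p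
  simp only at h4 h5 h0
  simp only [altInv_apply, slant_apply, h0]
  repeat rw [triple_gen e hm _ w (by simp only; lia)]
  simp

variable {w₁ : Fin n → A} {w₂ : Pairs n → A} {w₃ : Triples n → A}

theorem delta3_standard (hm : ∀ l, 0 < m l) (h₁ : ∀ l, m l • w₁ l = 0)
    (h₂ : ∀ p : Pairs n, m p.1.2 • w₂ p = 0) (h₃ : ∀ p, gcd3 m p • w₃ p = 0) :
    delta3 (standard e w₁ w₂ w₃) = 0 := by
  rw [standard, map_sub, map_add, map_sum, map_sum, map_sum,
    Finset.sum_eq_zero fun l _ => delta3_cupCarry (expo_mul e hm l)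
      (expo_mul_nsmul e hm l (h₁ l)) (hm l),
    Finset.sum_eq_zero fun (p : Pairs n) _ => delta3_cupCarry (expo_mul e hm p.1.1)
      (expo_mul_nsmul e hm p.1.2 (h₂ p)) (hm p.1.1),
    Finset.sum_eq_zero fun p _ => delta3_triple e hm p (h₃ p)]
  simp

theorem expo_div_eq_zero (hm : ∀ l, 0 < m l) (l : Fin n) (x : G) : expo e l x / m l = 0 := by
  have : NeZero (m l) := ⟨(hm l).ne'⟩
  exact Nat.div_eq_of_lt (ZMod.val_lt _)

theorem normalized_standard (hm : ∀ l, 0 < m l) : Normalized (standard e w₁ w₂ w₃) := by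
  intro x y
  simp [standard, cupCarry, triple, expo_one, expo_div_eq_zero e hm, Finset.sum_apply]

theorem cyclicInv_standard (hm : ∀ l, 0 < m l) (h₁ : ∀ l, m l • w₁ l = 0) (l : Fin n) :
    cyclicInv (gen e l) (m l) (standard e w₁ w₂ w₃) = w₁ l := by
  rw [standard, map_sub, map_add, map_sum, map_sum, map_sum,
    Finset.sum_eq_zero fun p _ => cyclicInv_triple e hm p _ l _, Finset.sum_eq_single l,
    Finset.sum_eq_zero, sub_zero, add_zero, cyclicInv_cupCarry,
    carrySum_self (hm l) (expo_mul e hm l) (gen_pow e l), expo_gen_self, nsmul_mod (h₁ l),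
    one_smul, nsmul_mod (h₁ l), one_smul]
  · rintro ⟨⟨s, t⟩, hst⟩ _
    rw [cyclicInv_cupCarry]
    rcases eq_or_ne t l with rfl | h
    · rw [carrySum_of_eq_zero (hm s) (expo_mul e hm s) (gen_pow e _)
        (expo_gen_of_ne e (ne_of_lt hst)), zero_smul]
    · simp [expo_gen_of_ne e h]
  · intro l' _ h
    simp [cyclicInv_cupCarry, expo_gen_of_ne e h]
  · simp

theorem slantSum_cupCarry_of_ne (hm : ∀ l, 0 < m l) {a b s t : Fin n} (h : s ≠ b ∨ t ≠ a) (w : A) :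
    slantSum (gen e a) (gen e b) (m b) (cupCarry (fun x => expo e t x • w) (expo e s) (m s)) =
      0 := by
  rw [slantSum_cupCarry]
  rcases h with h | h
  · rw [carrySum_of_eq_zero (hm s) (expo_mul e hm s) (gen_pow e _) (expo_gen_of_ne e h), zero_smul]
  · rw [expo_gen_of_ne e h, zero_smul, smul_zero]

/-- Only `w₂ p` contributes, through the slant product with the generator of the second factor. Its
coefficient is `1 % m_s`, which may be `0` when `m_s = 1`; then `(m_s, m_t) = 1`, and both sides
vanish. -/
theorem pairInv_standard (hm : ∀ l, 0 < m l) (h₂ : ∀ p : Pairs n, m p.1.2 • w₂ p = 0)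
    (p : Pairs n) :
    pairInv (gen e p.1.1) (gen e p.1.2) (m p.1.1) (m p.1.2) (standard e w₁ w₂ w₃) =
      (m p.1.2 / gcd2 m p) • w₂ p := by
  have hp := p.2
  have h0 : ∀ a b : Fin n, a ≠ b → ∀ l : Fin n, slantSum (gen e a) (gen e b) (m b)
      (cupCarry (fun x => expo e l x • w₁ l) (expo e l) (m l)) = 0 := fun a b h l =>
    slantSum_cupCarry_of_ne e hm (by lia) _
  have h1 : slantSum (gen e p.1.1) (gen e p.1.2) (m p.1.2) (standard e w₁ w₂ w₃) = 0 := by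
    rw [standard, map_sub, map_add, map_sum, map_sum, map_sum,
      Finset.sum_eq_zero fun l _ => h0 _ _ hp.ne l,
      Finset.sum_eq_zero fun q _ => slantSum_triple e hm q _ _ _ _, Finset.sum_eq_zero]
    · simp
    · intro q _
      have := q.2
      exact slantSum_cupCarry_of_ne e hm (by lia) _
  have h2 : slantSum (gen e p.1.2) (gen e p.1.1) (m p.1.1) (standard e w₁ w₂ w₃) =
      (1 % m p.1.1) • w₂ p := by
    rw [standard, map_sub, map_add, map_sum, map_sum, map_sum,
      Finset.sum_eq_zero fun l _ => h0 _ _ hp.ne' l,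
      Finset.sum_eq_zero fun q _ => slantSum_triple e hm q _ _ _ _, Finset.sum_eq_single p,
      sub_zero, zero_add, slantSum_cupCarry, carrySum_self (hm _) (expo_mul e hm _) (gen_pow e _),
      expo_gen_self, expo_gen_self, nsmul_mod (h₂ p), one_smul]
    · intro q _ hq
      refine slantSum_cupCarry_of_ne e hm ?_ _
      by_contra! h
      exact hq (Subtype.ext (Prod.ext h.1 h.2))
    · simp
  rw [pairInv_apply, h1, h2, smul_zero, zero_add, smul_comm, nsmul_mod, one_smul]
  rw [smul_smul, mul_comm, ← div_gcd_mul, mul_smul, h₂, smul_zero]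

theorem altInv_standard (hm : ∀ l, 0 < m l) (h₃ : ∀ p, gcd3 m p • w₃ p = 0) (p : Triples n) :
    altInv (gen e p.1.1) (gen e p.1.2.1) (gen e p.1.2.2) (standard e w₁ w₂ w₃) = w₃ p := by
  rw [standard, map_sub, map_add, map_sum, map_sum, map_sum,
    Finset.sum_eq_zero fun l _ => altInv_cupCarry _ _ _ _ _ _,
    Finset.sum_eq_zero fun l _ => altInv_cupCarry _ _ _ _ _ _, Finset.sum_eq_single p,
    altInv_triple e hm p (h₃ p)]
  · simp
  · exact fun q _ hq => altInv_triple_of_ne e hm q p hq _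
  · simp

end Standard

/-! ### Coefficients in the units of a field -/

section Units

variable {G A : Type*} [CommGroup G] [AddCommGroup A] {n : ℕ} {m : Fin n → ℕ}

/-- `exists_eq_delta2` for an abstract group with chosen generators of cyclic factors. -/
theorem exists_eq_delta2_of_mulEquiv [DivisibleBy A ℤ]
    (hA : ∀ p q : ℕ, 0 < p → ∀ a : A, (p / p.gcd q) • a = 0 → ∃ w, p • w = 0 ∧ q • w = a)
    (hm : ∀ l, 0 < m l) (e : G ≃* ∀ l : Fin n, Multiplicative (ZMod (m l)))
    {f : G → G → G → A} (hf : delta3 f = 0)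
    (h₁ : ∀ l, cyclicInv (gen e l) (m l) f = 0)
    (h₂ : ∀ p : Pairs n, pairInv (gen e p.1.1) (gen e p.1.2) (m p.1.1) (m p.1.2) f = 0)
    (h₃ : ∀ p : Triples n, altInv (gen e p.1.1) (gen e p.1.2.1) (gen e p.1.2.2) f = 0) :
    ∃ J, f = delta2 J := by
  have hg : ∀ l, e.symm (gen (MulEquiv.refl _) l) = gen e l := fun _ => rfl
  obtain ⟨J, hJ⟩ := exists_eq_delta2 hA m hm (fun x y z => f (e.symm x) (e.symm y) (e.symm z))
    (by
      funext x y z w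
      have := cocycle_apply hf (e.symm x) (e.symm y) (e.symm z) (e.symm w)
      simp only [← map_mul] at this
      exact this)
    (fun l => by
      have := h₁ l
      simp only [← hg, cyclicInv_apply, ← map_pow] at this
      exact this)
    (fun s t hst => by
      have := h₂ ⟨(s, t), hst⟩
      simp only [← hg, pairInv_apply, slantSum_apply, ← map_pow] at this
      exact this)
    (fun x y z => altInv_eq_zero e hm hf (fun r s t h h' => h₃ ⟨(r, s, t), h, h'⟩) _ _ _)
  refine ⟨fun x y => J (e x) (e y), ?_⟩
  funext x y z
  have := congrFun (congrFun (congrFun hJ (e x)) (e y)) (e z)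
  simp only [e.symm_apply_apply, delta2_apply] at this
  simp only [this, delta2_apply, map_mul]

variable {k : Type*} [Field k]

/-- The multiplicative group of an algebraically closed field is divisible. -/
noncomputable instance divisibleByUnits [IsAlgClosed k] : DivisibleBy (Additive kˣ) ℤ :=
  let _ : DivisibleBy (Additive kˣ) ℕ := divisibleByOfSMulRightSurj _ _ fun {N} hN a => by
    obtain ⟨x, hx⟩ := IsAlgClosed.exists_pow_nat_eq (a.toMul : k) (Nat.pos_of_ne_zero hN)
    have hx0 : x ≠ 0 := fun h => a.toMul.ne_zero (by rw [← hx, h, zero_pow hN])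
    exact ⟨Additive.ofMul (Units.mk0 x hx0), by
      change Units.mk0 x hx0 ^ N = a.toMul
      ext
      simpa using hx⟩
  AddGroup.divisibleByIntOfDivisibleByNat _

theorem exists_nsmul_eq_of_isPrimitiveRoot {ξ : kˣ} {N : ℕ} (h : IsPrimitiveRoot ξ N)
    (hN : 0 < N) {a : Additive kˣ} (ha : N • a = 0) : ∃ i < N, i • Additive.ofMul ξ = a := by
  have : NeZero N := ⟨hN.ne'⟩
  have h1 : ((a.toMul : kˣ) : k) ^ N = 1 := by
    rw [← Units.val_pow_eq_pow_val, ← toMul_nsmul, ha, toMul_zero, Units.val_one]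
  obtain ⟨i, hi, e⟩ := (IsPrimitiveRoot.coe_units_iff.mpr h).eq_pow_of_pow_eq_one h1
  refine ⟨i, hi, ?_⟩
  apply Additive.toMul.injective
  ext
  simpa using e

/-- The arithmetic condition on the coefficients in `exists_eq_delta2`: an element killed by
`p / gcd p q` is divisible by `q` among the elements killed by `p`. -/
theorem exists_nsmul_eq_zero_and_nsmul_eq {ζ : ℕ → kˣ}
    (hζ : ∀ N : ℕ, 0 < N → IsPrimitiveRoot (ζ N) N) (p q : ℕ) (hp : 0 < p) (a : Additive kˣ)
    (ha : (p / p.gcd q) • a = 0) : ∃ w, p • w = 0 ∧ q • w = a := by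
  have hd : 0 < p.gcd q := Nat.gcd_pos_of_pos_left _ hp
  have h1 : IsPrimitiveRoot (ζ p ^ p.gcd q) (p / p.gcd q) :=
    (hζ p hp).pow hp (Nat.mul_div_cancel' (Nat.gcd_dvd_left p q)).symm
  obtain ⟨c, -, hc⟩ := exists_nsmul_eq_of_isPrimitiveRoot h1
    (Nat.div_pos (Nat.gcd_le_left _ hp) hd) ha
  have hz : (p : ℤ) • Additive.ofMul (ζ p) = 0 := by
    rw [natCast_zsmul]
    exact (hζ p hp).pow_eq_one
  -- By Bézout, multiplication by `q` is onto the multiples of `gcd p q` modulo `p`.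
  refine ⟨(p.gcdB q * c) • Additive.ofMul (ζ p), ?_, ?_⟩
  · rw [← natCast_zsmul, smul_comm, hz, smul_zero]
  · have h2 : a = ((p.gcd q : ℤ) * c) • Additive.ofMul (ζ p) := by
      rw [mul_comm, mul_smul, natCast_zsmul, natCast_zsmul]
      exact hc.symm
    rw [h2, Nat.gcd_eq_gcd_ab, ← natCast_zsmul, ← mul_smul]
    have h3 : (p * p.gcdA q + q * p.gcdB q) * (c : ℤ) =
        q * (p.gcdB q * c) + p.gcdA q * c * p := by ring
    rw [h3, add_zsmul, mul_smul _ (p : ℤ), hz, smul_zero, add_zero]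

theorem ofMul_Phi (ζ : ℕ → kˣ) (e : G ≃* ∀ l : Fin n, Multiplicative (ZMod (m l))) (a : Param m) :
    (fun x y z => Additive.ofMul (Phi ζ e a x y z)) = standard e
      (fun l => (a.one l : ℕ) • Additive.ofMul (ζ (m l)))
      (fun p => (a.two p : ℕ) • Additive.ofMul (ζ (m p.1.2)))
      (fun p => (a.three p : ℕ) • Additive.ofMul (ζ (gcd3 m p))) := by
  funext x y z
  simp only [Phi, standard, ofMul_mul, ofMul_prod, ofMul_inv, ofMul_pow, Finset.sum_neg_distrib,
    Pi.add_apply, Pi.sub_apply, Finset.sum_apply, cupCarry, triple, sub_eq_add_neg, smul_smul]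
  congr 1
  · congr 1 <;> refine Finset.sum_congr rfl fun l _ => ?_ <;> congr 1 <;> ring
  · congr 1
    refine Finset.sum_congr rfl fun l _ => ?_
    congr 1
    ring

end Units

/-! ### The classification -/

section Classification

variable {G A : Type*} [CommGroup G] [AddCommGroup A] {n : ℕ} {m : Fin n → ℕ} {k : Type*} [Field k]

/-- The group in which the three families of invariants take their values. -/
abbrev Invariants (n : ℕ) (A : Type*) := (Fin n → A) × (Pairs n → A) × (Triples n → A)

/-- All the invariants of a 3-cochain. -/
def invariants (e : G ≃* ∀ l : Fin n, Multiplicative (ZMod (m l))) :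
    (G → G → G → A) →+ Invariants n A where
  toFun f := (fun l => cyclicInv (gen e l) (m l) f,
    fun p => pairInv (gen e p.1.1) (gen e p.1.2) (m p.1.1) (m p.1.2) f,
    fun p => altInv (gen e p.1.1) (gen e p.1.2.1) (gen e p.1.2.2) f)
  map_zero' := by ext <;> simp
  map_add' f f' := by ext <;> simp

theorem invariants_delta2 (e : G ≃* ∀ l : Fin n, Multiplicative (ZMod (m l))) (J : G → G → A) :
    invariants e (delta2 J) = 0 := by
  refine Prod.ext ?_ (Prod.ext ?_ ?_)
  · exact funext fun l => cyclicInv_delta2 J (gen_pow e l)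
  · exact funext fun p => pairInv_delta2 J (gen_pow e _) (gen_pow e _)
  · exact funext fun p => altInv_delta2 J _ _ _

/-- The values of the invariants that are killed by `m_l`, `(m_s, m_t)` and `(m_r, m_s, m_t)`. -/
def IsTorsion (m : Fin n → ℕ) (u : Invariants n A) : Prop :=
  (∀ l, m l • u.1 l = 0) ∧ (∀ p, gcd2 m p • u.2.1 p = 0) ∧ ∀ p, gcd3 m p • u.2.2 p = 0

theorem isTorsion_invariants (e : G ≃* ∀ l : Fin n, Multiplicative (ZMod (m l)))
    {f : G → G → G → A} (hf : delta3 f = 0) : IsTorsion m (invariants e f) :=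
  ⟨fun l => cyclicInv_nsmul hf (gen_pow e l),
    fun _ => pairInv_nsmul hf (gen_pow e _) (gen_pow e _),
    fun _ => altInv_nsmul_gcd hf (gen_pow e _) (gen_pow e _) (gen_pow e _)⟩

theorem exists_eq_delta2_of_invariants [DivisibleBy A ℤ]
    (hA : ∀ p q : ℕ, 0 < p → ∀ a : A, (p / p.gcd q) • a = 0 → ∃ w, p • w = 0 ∧ q • w = a)
    (hm : ∀ l, 0 < m l) (e : G ≃* ∀ l : Fin n, Multiplicative (ZMod (m l)))
    {f : G → G → G → A} (hf : delta3 f = 0) (h : invariants e f = 0) : ∃ J, f = delta2 J :=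
  exists_eq_delta2_of_mulEquiv hA hm e hf (fun l => congrFun (congrArg Prod.fst h) l)
    (fun p => congrFun (congrArg (fun u => u.2.1) h) p)
    (fun p => congrFun (congrArg (fun u => u.2.2) h) p)

/-- The passage from 3-cochains with values in `kˣ` to 3-cochains with values in `Additive kˣ`, as a
homomorphism of multiplicative groups. -/
def toAdditive : (G → G → G → kˣ) →* Multiplicative (G → G → G → Additive kˣ) where
  toFun f := Multiplicative.ofAdd fun x y z => Additive.ofMul (f x y z)
  map_one' := rfl
  map_mul' _ _ := rfl

theorem mem_Z3_iff (f : G → G → G → kˣ) :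
    f ∈ Z3 G kˣ ↔ delta3 (fun x y z => Additive.ofMul (f x y z)) = 0 := by
  have h : ∀ x y z w, Additive.ofMul (d3 G kˣ f x y z w) =
      delta3 (fun x y z => Additive.ofMul (f x y z)) x y z w := fun x y z w => by
    simp only [d3, delta3, MonoidHom.coe_mk, OneHom.coe_mk, AddMonoidHom.coe_mk, ZeroHom.coe_mk,
      ofMul_mul, ofMul_inv]
    abel
  rw [Z3, MonoidHom.mem_ker]
  refine ⟨fun H => ?_, fun H => ?_⟩
  · funext x y z w
    rw [← h, H]
    rfl
  · funext x y z w
    apply Additive.ofMul.injective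
    rw [h, H]
    rfl

theorem eq_d2_iff (f : G → G → G → kˣ) (J : G → G → kˣ) :
    f = d2 G kˣ J ↔
      (fun x y z => Additive.ofMul (f x y z)) = delta2 fun x y => Additive.ofMul (J x y) := by
  have h : ∀ x y z, Additive.ofMul (d2 G kˣ J x y z) =
      delta2 (fun x y => Additive.ofMul (J x y)) x y z := fun x y z => by
    simp only [d2, MonoidHom.coe_mk, OneHom.coe_mk, delta2_apply, ofMul_mul, ofMul_inv]
    abel
  refine ⟨fun H => ?_, fun H => ?_⟩
  · funext x y z
    rw [← h, H]
  · funext x y z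
    apply Additive.ofMul.injective
    rw [h, ← H]

variable {ζ : ℕ → kˣ}

theorem ofMul_nsmul_eq_zero (hζ : ∀ N : ℕ, 0 < N → IsPrimitiveRoot (ζ N) N) {N : ℕ} (hN : 0 < N)
    (a : ℕ) : N • a • Additive.ofMul (ζ N) = 0 := by
  rw [smul_comm, ← ofMul_pow, (hζ N hN).pow_eq_one, ofMul_one, smul_zero]

theorem gcd2_pos (hm : ∀ l, 0 < m l) (p : Pairs n) : 0 < gcd2 m p :=
  Nat.gcd_pos_of_pos_left _ (hm _)

theorem gcd3_pos (hm : ∀ l, 0 < m l) (p : Triples n) : 0 < gcd3 m p :=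
  Nat.gcd_pos_of_pos_left _ (Nat.gcd_pos_of_pos_left _ (hm _))

theorem delta3_Phi (hζ : ∀ N : ℕ, 0 < N → IsPrimitiveRoot (ζ N) N) (hm : ∀ l, 0 < m l)
    (e : G ≃* ∀ l : Fin n, Multiplicative (ZMod (m l))) (a : Param m) :
    delta3 (fun x y z => Additive.ofMul (Phi ζ e a x y z)) = 0 := by
  rw [ofMul_Phi]
  exact delta3_standard e hm (fun l => ofMul_nsmul_eq_zero hζ (hm l) _)
    (fun p => ofMul_nsmul_eq_zero hζ (hm _) _)
    (fun p => ofMul_nsmul_eq_zero hζ (gcd3_pos hm p) _)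

theorem normalized_Phi (hm : ∀ l, 0 < m l) (ζ : ℕ → kˣ)
    (e : G ≃* ∀ l : Fin n, Multiplicative (ZMod (m l))) (a : Param m) :
    Normalized (fun x y z => Additive.ofMul (Phi ζ e a x y z)) := by
  rw [ofMul_Phi]
  exact normalized_standard e hm

/-- The root of unity of order `(m_s, m_t)` whose power `a_st` is an invariant of `Φ_a`. -/
theorem isPrimitiveRoot_pair (hζ : ∀ N : ℕ, 0 < N → IsPrimitiveRoot (ζ N) N)
    (hm : ∀ l, 0 < m l) (p : Pairs n) :
    IsPrimitiveRoot (ζ (m p.1.2) ^ (m p.1.2 / gcd2 m p)) (gcd2 m p) :=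
  (hζ _ (hm _)).pow (hm _) (Nat.div_mul_cancel (Nat.gcd_dvd_right _ _)).symm

theorem invariants_Phi (hζ : ∀ N : ℕ, 0 < N → IsPrimitiveRoot (ζ N) N) (hm : ∀ l, 0 < m l)
    (e : G ≃* ∀ l : Fin n, Multiplicative (ZMod (m l))) (a : Param m) :
    invariants e (fun x y z => Additive.ofMul (Phi ζ e a x y z)) =
      (fun l => (a.one l : ℕ) • Additive.ofMul (ζ (m l)),
        fun p => (a.two p : ℕ) • Additive.ofMul (ζ (m p.1.2) ^ (m p.1.2 / gcd2 m p)),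
        fun p => (a.three p : ℕ) • Additive.ofMul (ζ (gcd3 m p))) := by
  rw [ofMul_Phi]
  refine Prod.ext ?_ (Prod.ext ?_ ?_)
  · exact funext fun l => cyclicInv_standard e hm (fun l => ofMul_nsmul_eq_zero hζ (hm l) _) l
  · refine funext fun p => (pairInv_standard e hm
      (fun p => ofMul_nsmul_eq_zero hζ (hm _) _) p).trans ?_
    dsimp only
    rw [ofMul_pow, smul_comm]
  · exact funext fun p => altInv_standard e hm
      (fun p => ofMul_nsmul_eq_zero hζ (gcd3_pos hm p) _) p

theorem invariants_Phi_injective (hζ : ∀ N : ℕ, 0 < N → IsPrimitiveRoot (ζ N) N)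
    (hm : ∀ l, 0 < m l) (e : G ≃* ∀ l : Fin n, Multiplicative (ZMod (m l))) {a b : Param m}
    (h : invariants e (fun x y z => Additive.ofMul (Phi ζ e a x y z)) =
      invariants e (fun x y z => Additive.ofMul (Phi ζ e b x y z))) : a = b := by
  rw [invariants_Phi hζ hm, invariants_Phi hζ hm] at h
  simp only [Prod.mk.injEq, funext_iff] at h
  obtain ⟨h1, h2, h3⟩ := h
  ext x
  · exact (hζ _ (hm x)).pow_inj (a.one x).2 (b.one x).2 (h1 x)
  · exact (isPrimitiveRoot_pair hζ hm x).pow_inj (a.two x).2 (b.two x).2 (h2 x)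
  · exact (hζ _ (gcd3_pos hm x)).pow_inj (a.three x).2 (b.three x).2 (h3 x)

theorem exists_invariants_Phi_eq (hζ : ∀ N : ℕ, 0 < N → IsPrimitiveRoot (ζ N) N)
    (hm : ∀ l, 0 < m l) (e : G ≃* ∀ l : Fin n, Multiplicative (ZMod (m l)))
    {u : Invariants n (Additive kˣ)} (hu : IsTorsion m u) :
    ∃ a : Param m, invariants e (fun x y z => Additive.ofMul (Phi ζ e a x y z)) = u := by
  choose a₁ ha₁ h₁ using fun l => exists_nsmul_eq_of_isPrimitiveRoot (hζ _ (hm l)) (hm l) (hu.1 l)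
  choose a₂ ha₂ h₂ using fun p => exists_nsmul_eq_of_isPrimitiveRoot (isPrimitiveRoot_pair hζ hm p)
    (gcd2_pos hm p) (hu.2.1 p)
  choose a₃ ha₃ h₃ using fun p => exists_nsmul_eq_of_isPrimitiveRoot (hζ _ (gcd3_pos hm p))
    (gcd3_pos hm p) (hu.2.2 p)
  refine ⟨⟨fun l => ⟨a₁ l, ha₁ l⟩, fun p => ⟨a₂ p, ha₂ p⟩, fun p => ⟨a₃ p, ha₃ p⟩⟩, ?_⟩
  rw [invariants_Phi hζ hm]
  exact Prod.ext (funext h₁) (Prod.ext (funext h₂) (funext h₃))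

/-- The embedding of `ℤ/N` into the units of a field defined by a primitive root of unity. -/
noncomputable def rootHom {ξ : kˣ} {N : ℕ} (h : IsPrimitiveRoot ξ N) : ZMod N →+ Additive kˣ :=
  (MonoidHom.toAdditive (Subgroup.zpowers ξ).subtype).comp h.zmodEquivZPowers.toAddMonoidHom

theorem rootHom_injective {ξ : kˣ} {N : ℕ} (h : IsPrimitiveRoot ξ N) :
    Function.Injective (rootHom h) := fun _ _ hab =>
  h.zmodEquivZPowers.injective (Subtype.val_injective hab)

theorem nsmul_rootHom {ξ : kˣ} {N : ℕ} (h : IsPrimitiveRoot ξ N) (v : ZMod N) :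
    N • rootHom h v = 0 := by
  rw [← map_nsmul, nsmul_eq_mul, CharP.cast_eq_zero, zero_mul, map_zero]

theorem exists_rootHom_eq {ξ : kˣ} {N : ℕ} (h : IsPrimitiveRoot ξ N) (hN : 0 < N)
    {a : Additive kˣ} (ha : N • a = 0) : ∃ v, rootHom h v = a := by
  obtain ⟨i, -, hi⟩ := exists_nsmul_eq_of_isPrimitiveRoot h hN ha
  refine ⟨i, ?_⟩
  rw [← hi, rootHom, AddMonoidHom.comp_apply]
  change MonoidHom.toAdditive (Subgroup.zpowers ξ).subtype (h.zmodEquivZPowers i) = _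
  rw [h.zmodEquivZPowers_apply_coe_nat]
  rfl

/-- The embedding of the product of the groups `ℤ/m_l`, `ℤ/(m_s, m_t)`, `ℤ/(m_r, m_s, m_t)` into the
possible values of the invariants; its image consists of the torsion values. -/
noncomputable def torsionHom (hζ : ∀ N : ℕ, 0 < N → IsPrimitiveRoot (ζ N) N) (hm : ∀ l, 0 < m l) :
    ((∀ l : Fin n, ZMod (m l)) × (∀ p : Pairs n, ZMod (gcd2 m p)) ×
      (∀ p : Triples n, ZMod (gcd3 m p))) →+ Invariants n (Additive kˣ) where
  toFun v := (fun l => rootHom (hζ _ (hm l)) (v.1 l),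
    fun p => rootHom (hζ _ (gcd2_pos hm p)) (v.2.1 p),
    fun p => rootHom (hζ _ (gcd3_pos hm p)) (v.2.2 p))
  map_zero' := by ext <;> simp
  map_add' v v' := by ext <;> simp

theorem torsionHom_injective (hζ : ∀ N : ℕ, 0 < N → IsPrimitiveRoot (ζ N) N)
    (hm : ∀ l, 0 < m l) : Function.Injective (torsionHom hζ hm) := by
  intro v v' h
  simp only [torsionHom, AddMonoidHom.coe_mk, ZeroHom.coe_mk, Prod.mk.injEq, funext_iff] at h
  exact Prod.ext (funext fun l => rootHom_injective _ (h.1 l))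
    (Prod.ext (funext fun p => rootHom_injective _ (h.2.1 p))
      (funext fun p => rootHom_injective _ (h.2.2 p)))

theorem mem_range_torsionHom (hζ : ∀ N : ℕ, 0 < N → IsPrimitiveRoot (ζ N) N)
    (hm : ∀ l, 0 < m l) (u : Invariants n (Additive kˣ)) :
    (∃ v, torsionHom hζ hm v = u) ↔ IsTorsion m u := by
  constructor
  · rintro ⟨v, rfl⟩
    exact ⟨fun l => nsmul_rootHom _ _, fun p => nsmul_rootHom _ _, fun p => nsmul_rootHom _ _⟩
  · intro hu
    choose v₁ h₁ using fun l => exists_rootHom_eq (hζ _ (hm l)) (hm l) (hu.1 l)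
    choose v₂ h₂ using fun p => exists_rootHom_eq (hζ _ (gcd2_pos hm p)) (gcd2_pos hm p) (hu.2.1 p)
    choose v₃ h₃ using fun p => exists_rootHom_eq (hζ _ (gcd3_pos hm p)) (gcd3_pos hm p) (hu.2.2 p)
    exact ⟨(v₁, v₂, v₃), Prod.ext (funext h₁) (Prod.ext (funext h₂) (funext h₃))⟩

/-- The invariants of the 3-cocycles with values in `kˣ`. -/
def invariantsHom (k : Type*) [Field k] (e : G ≃* ∀ l : Fin n, Multiplicative (ZMod (m l))) :
    Z3 G kˣ →* Multiplicative (Invariants n (Additive kˣ)) :=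
  ((AddMonoidHom.toMultiplicative (invariants e)).comp toAdditive).comp (Z3 G kˣ).subtype

theorem invariantsHom_eq_one_iff [IsAlgClosed k]
    (hζ : ∀ N : ℕ, 0 < N → IsPrimitiveRoot (ζ N) N) (hm : ∀ l, 0 < m l)
    (e : G ≃* ∀ l : Fin n, Multiplicative (ZMod (m l))) (f : Z3 G kˣ) :
    invariantsHom k e f = 1 ↔ (f : G → G → G → kˣ) ∈ B3 G kˣ := by
  constructor
  · intro h
    obtain ⟨J, hJ⟩ := exists_eq_delta2_of_invariants (exists_nsmul_eq_zero_and_nsmul_eq hζ) hm e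
      ((mem_Z3_iff _).mp f.2) h
    exact ⟨fun x y => (J x y).toMul, ((eq_d2_iff _ _).mpr hJ).symm⟩
  · rintro ⟨J, hJ⟩
    have h := (eq_d2_iff _ _).mp hJ.symm
    change Multiplicative.ofAdd (invariants e (fun x y z => Additive.ofMul (f.1 x y z))) = 1
    rw [h, invariants_delta2]
    rfl

end Classification
end AbelianCocycles

open AbelianCocycles in
/-- `G` is the product of cyclic groups of orders `m_1, …, m_n`, with chosen generators (encoded by
the isomorphism `e`), and `ζ m` is a fixed primitive `m`-th root of unity for each `m > 0`.
Every `Φ_a` is a normalized 3-cocycle. Every normalized 3-cocycle is cohomologous to exactly one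
`Φ_a`: it differs from it by the coboundary of a normalized 2-cochain, while it does not differ
from any other `Φ_b` by a coboundary, normalized or not. Finally, `H³(G, kˣ)` is isomorphic to the
stated product of cyclic groups. -/
theorem proposition3p8 {k : Type*} [Field k] [IsAlgClosed k] [CharZero k]
    (ζ : ℕ → kˣ) (hζ : ∀ N : ℕ, 0 < N → IsPrimitiveRoot (ζ N) N)
    {n : ℕ} (m : Fin n → ℕ) (hm : ∀ l, 0 < m l)
    {G : Type*} [CommGroup G] (e : G ≃* ∀ l : Fin n, Multiplicative (ZMod (m l))) :
    (∀ a : AbelianCocycles.Param m,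
      AbelianCocycles.Phi ζ e a ∈ AbelianCocycles.Z3 G kˣ ∧
        AbelianCocycles.IsNormalized3 (AbelianCocycles.Phi ζ e a)) ∧
    (∀ f ∈ AbelianCocycles.Z3 G kˣ, AbelianCocycles.IsNormalized3 f →
      ∃ a : AbelianCocycles.Param m,
        (∃ J : G → G → kˣ, AbelianCocycles.IsNormalized2 J ∧
          f = AbelianCocycles.Phi ζ e a * AbelianCocycles.d2 G kˣ J) ∧
        ∀ b : AbelianCocycles.Param m,
          f / AbelianCocycles.Phi ζ e b ∈ AbelianCocycles.B3 G kˣ → b = a) ∧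
    Nonempty (AbelianCocycles.H3 G kˣ ≃*
      Multiplicative ((∀ l : Fin n, ZMod (m l)) ×
        (∀ p : AbelianCocycles.Pairs n, ZMod (AbelianCocycles.gcd2 m p)) ×
        (∀ p : AbelianCocycles.Triples n, ZMod (AbelianCocycles.gcd3 m p)))) := by
  refine ⟨fun a => ⟨(mem_Z3_iff _).mpr (delta3_Phi hζ hm e a), normalized_Phi hm ζ e a⟩,
    fun f hf hn => ?_, ?_⟩
  · obtain ⟨F, hF⟩ : ∃ F : G → G → G → Additive kˣ, F = fun x y z => Additive.ofMul (f x y z) :=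
      ⟨_, rfl⟩
    have hF₃ : delta3 F = 0 := hF ▸ (mem_Z3_iff f).mp hf
    have hFn : Normalized F := hF ▸ hn
    obtain ⟨a, ha⟩ := exists_invariants_Phi_eq hζ hm e (isTorsion_invariants e hF₃)
    refine ⟨a, ?_, fun b hb => ?_⟩
    · obtain ⟨J, hJ⟩ := exists_eq_delta2_of_invariants (exists_nsmul_eq_zero_and_nsmul_eq hζ) hm e
        (f := F - fun x y z => Additive.ofMul (Phi ζ e a x y z))
        (by rw [map_sub, hF₃, delta3_Phi hζ hm, sub_zero]) (by rw [map_sub, ha, sub_self])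
      have hJn : Normalized (delta2 J) := by
        rw [← hJ]
        intro x y
        have h1 := hFn x y
        have h2 := normalized_Phi hm ζ e a x y
        simp only [Pi.sub_apply, h1, h2, sub_self, and_self]
      obtain ⟨J', hJ', hl, hr⟩ := exists_normalized_of_delta2 hJn
      refine ⟨fun x y => (J' x y).toMul, fun x => ⟨hl x, hr x⟩, ?_⟩
      rw [← div_eq_iff_eq_mul', eq_d2_iff]
      subst hF
      exact hJ.trans hJ'.symm
    · obtain ⟨J, hJ⟩ := hb
      have h := (eq_d2_iff _ _).mp hJ.symm
      have h' : F - (fun x y z => Additive.ofMul (Phi ζ e b x y z)) =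
          delta2 fun x y => Additive.ofMul (J x y) := by subst hF; exact h
      have h2 := congrArg (invariants e) h'
      rw [map_sub, invariants_delta2, sub_eq_zero, ← ha] at h2
      exact (invariants_Phi_injective hζ hm e h2).symm
  · have hker : (B3 G kˣ).subgroupOf (Z3 G kˣ) = (invariantsHom k e).ker := by
      ext f
      rw [MonoidHom.mem_ker, invariantsHom_eq_one_iff hζ hm, Subgroup.mem_subgroupOf]
    have hrange : (invariantsHom k e).range =
        (AddMonoidHom.toMultiplicative (torsionHom hζ hm)).range := by
      ext u
      refine Iff.trans ⟨?_, fun hu => ?_⟩ (mem_range_torsionHom hζ hm u.toAdd).symm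
      · rintro ⟨f, rfl⟩
        exact isTorsion_invariants e ((mem_Z3_iff _).mp f.2)
      · obtain ⟨a, ha⟩ := exists_invariants_Phi_eq hζ hm e hu
        exact ⟨⟨Phi ζ e a, (mem_Z3_iff _).mpr (delta3_Phi hζ hm e a)⟩, ha⟩
    exact ⟨(QuotientGroup.quotientMulEquivOfEq hker).trans
      ((QuotientGroup.quotientKerEquivRange _).trans ((MulEquiv.subgroupCongr hrange).trans
        (MonoidHom.ofInjective (torsionHom_injective hζ hm)).symm))⟩
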